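/- Theorem 2. For a sequence $a=(a_0,\dots,a_{n-1})$ of real numbers and a sequence $b=(b_0,\dots,b_{m-1})$ with $1\le m\le n$, the reduced $(\min,+)$-convolution of $a$ and $b$ is the sequence $$c_k=\min_{0\le i\le m-1}\{a_{k+i}+b_i\},\qquad 0\le k\le n-m .$$ Consider a random access machine with finitely many registers and arrays, which hold real numbers, and whose elementary operations (each of cost one) are addition, subtraction, multiplication and comparison of two registers, loading an integer constant, and reading or writing an array cell whose index is a natural number held in a register. There is a program for this machine and an absolute constant $C$ such that, for all integers $d\ge 1$, $n\ge 2$, $1\le m\le n$, all polynomials $f\in\mathbb{Z}[x]$ of degree at most $d$ and all real $a_0,\dots,a_{n-1}$, the program, given $n$, $m$, $d$, the coefficients of $f$ and the sequence $a$, computes the reduced $(\min,+)$-convolution of $a$ and $b$, where $b_i=f(i)$ for $0\le i\le m-1$, with at most $$C\cdot d^3\cdot n^{1+\frac{\sigma-1}{\sigma}}\cdot\log^2(n)$$ elementary operations, where $\sigma=\log_2(d)+\frac{1}{1+\log_2(d)}$. Moreover, if all $a_i$ are rational, then all values computed by the program are rational numbers whose bit size is bounded by a fixed polynomial in the bit size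 of the input. -/

import Mathlib

/-! A random access machine over the real numbers. A program uses finitely many registers and
finitely many arrays (both named by natural numbers), and is written in a structured imperative
language. The elementary operations are addition, subtraction, multiplication and comparison of
two registers, loading an integer constant, and reading or writing one array cell. There is no
division, no rounding and no non-integer constant. Every elementary operation costs one step. -/

namespace RealRAM

/-- The arithmetic operations. -/
inductive ArithOp where
  | add
  | sub
  | mul

/-- The value of an arithmetic operation. -/
def ArithOp.eval : ArithOp → ℝ → ℝ → ℝ
  | .add, u, v => u + v
  | .sub, u, v => u - v
  | .mul, u, v => u * v

/-- Programs. Registers `x y z` and arrays `A` are fixed in the text of the program. -/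
inductive Cmd where
  /-- do nothing -/
  | skip
  /-- `x := c` -/
  | const (x : ℕ) (c : ℤ)
  /-- `x := y o z` -/
  | arith (o : ArithOp) (x y z : ℕ)
  /-- `x := A[y]` -/
  | load (x A y : ℕ)
  /-- `A[y] := x` -/
  | store (A y x : ℕ)
  /-- first `P`, then `Q` -/
  | seq (P Q : Cmd)
  /-- if `x < y` then `P` else `Q` -/
  | ifLt (x y : ℕ) (P Q : Cmd)
  /-- while `x < y` do `P` -/
  | whileLt (x y : ℕ) (P : Cmd)

/-- The contents of the registers and of the arrays. -/
@[ext]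
structure State where
  reg : ℕ → ℝ
  arr : ℕ → ℕ → ℝ

/-- `s` with the value `v` written to the register `x`. -/
def State.setReg (s : State) (x : ℕ) (v : ℝ) : State :=
  { reg := Function.update s.reg x v, arr := s.arr }

/-- `s` with the value `v` written to the `k`-th cell of the array `A`. -/
def State.setArr (s : State) (A k : ℕ) (v : ℝ) : State :=
  { reg := s.reg, arr := Function.update s.arr A (Function.update (s.arr A) k v) }

/-- `Exec V P s t s'`: started in the state `s`, the program `P` terminates in the state `s'`
after exactly `t` elementary operations, and every value that it computes on the way
satisfies `V`. An array can only be accessed at an index that is a natural number; otherwise the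
program gets stuck and there is no terminating execution. -/
inductive Exec (V : ℝ → Prop) : Cmd → State → ℕ → State → Prop
  | skip (s : State) : Exec V .skip s 1 s
  | const (s : State) (x : ℕ) (c : ℤ) (hV : V (c : ℝ)) :
      Exec V (.const x c) s 1 (s.setReg x (c : ℝ))
  | arith (s : State) (o : ArithOp) (x y z : ℕ) (hV : V (o.eval (s.reg y) (s.reg z))) :
      Exec V (.arith o x y z) s 1 (s.setReg x (o.eval (s.reg y) (s.reg z)))
  | load (s : State) (x A y k : ℕ) (hk : s.reg y = (k : ℝ)) :
      Exec V (.load x A y) s 1 (s.setReg x (s.arr A k))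
  | store (s : State) (A y x k : ℕ) (hk : s.reg y = (k : ℝ)) :
      Exec V (.store A y x) s 1 (s.setArr A k (s.reg x))
  | seq (P Q : Cmd) (s s' s'' : State) (t t' : ℕ)
      (hP : Exec V P s t s') (hQ : Exec V Q s' t' s'') :
      Exec V (.seq P Q) s (t + t') s''
  | ifTrue (x y : ℕ) (P Q : Cmd) (s s' : State) (t : ℕ)
      (h : s.reg x < s.reg y) (hP : Exec V P s t s') :
      Exec V (.ifLt x y P Q) s (t + 1) s'
  | ifFalse (x y : ℕ) (P Q : Cmd) (s s' : State) (t : ℕ)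
      (h : ¬ s.reg x < s.reg y) (hQ : Exec V Q s t s') :
      Exec V (.ifLt x y P Q) s (t + 1) s'
  | whileTrue (x y : ℕ) (P : Cmd) (s s' s'' : State) (t t' : ℕ)
      (h : s.reg x < s.reg y) (hP : Exec V P s t s')
      (hW : Exec V (.whileLt x y P) s' t' s'') :
      Exec V (.whileLt x y P) s (t + t' + 1) s''
  | whileFalse (x y : ℕ) (P : Cmd) (s : State) (h : ¬ s.reg x < s.reg y) :
      Exec V (.whileLt x y P) s 1 s

end RealRAM

namespace MinConv

/-- The bit size of a rational number written as a reduced fraction (with one bit for the sign). -/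
def ratSize (q : ℚ) : ℕ := 1 + Nat.size q.num.natAbs + Nat.size q.den

/-- The real number `v` is rational, of bit size at most `L`. -/
def HasSizeLE (L : ℕ) (v : ℝ) : Prop := ∃ q : ℚ, (q : ℝ) = v ∧ ratSize q ≤ L

/-- The bit size of an instance: the lengths `n` and `m`, the degree bound `d`, the entries of
the sequence `a` and the coefficients of the polynomial `f`. -/
def inputSize (d n m : ℕ) (f : Polynomial ℤ) (a : Fin n → ℚ) : ℕ :=
  ratSize (n : ℚ) + ratSize (m : ℚ) + ratSize (d : ℚ) + (∑ i : Fin n, ratSize (a i)) +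
    ∑ j ∈ Finset.range (d + 1), ratSize (f.coeff j : ℚ)

/-- The initial state of the machine: `n`, `m`, `d` in the registers `0`, `1`, `2`, the sequence
`a` in the array `0`, the coefficients of `f` in the array `1`, and zeros elsewhere. -/
def inputState (d n m : ℕ) (f : Polynomial ℤ) (a : Fin n → ℝ) : RealRAM.State where
  reg := fun x =>
    if x = 0 then (n : ℝ) else if x = 1 then (m : ℝ) else if x = 2 then (d : ℝ) else 0
  arr := fun A i =>
    if A = 0 then (if h : i < n then a ⟨i, h⟩ else 0)
    else if A = 1 then (f.coeff i : ℝ)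
    else 0

/-- `c 0, …, c (n - m)` is the reduced `(min,+)`-convolution of `a` and `b`, that is
`c k = min {a (k + i) + b i : 0 ≤ i ≤ m - 1}` for `0 ≤ k ≤ n - m`. -/
def IsReducedMinConv {n m : ℕ} (a : Fin n → ℝ) (b : Fin m → ℝ) (c : ℕ → ℝ) : Prop :=
  ∀ (k : ℕ) (hk : k + m ≤ n),
    IsLeast (Set.range fun i : Fin m =>
      a ⟨k + i, lt_of_lt_of_le (Nat.add_lt_add_left i.isLt k) hk⟩ + b i) (c k)

/-- `σ = log₂ d + 1 / (1 + log₂ d)`. -/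
noncomputable def sigma (d : ℕ) : ℝ := Real.logb 2 d + 1 / (1 + Real.logb 2 d)

end MinConv

/-! Row `k` of the convolution is the minimum of `a j + F (j - k)` over the band `0 ≤ j - k < m`,
where `F i = f(i)`. On a `w × w` square of this matrix the differences `j - k` fill an interval of
radius `w - 1` around the difference `e` of the first column and the first row. If `F` is convex on
that interval, the square is a Monge matrix; if `F` is concave, it becomes one after its columns are
reversed. The row minima of a Monge matrix move monotonically, so O(w log w) steps find them all
(`Bracket.refine`, `wp_strides`).

The band is cut into squares of dyadic side, aligned in both coordinates. Each cell is served by the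
largest aligned square around it whose interval is good, that is, lies in the domain and carries a
convex or concave `F`. By maximality the interval of triple radius is not good, because it contains
the interval of the square of twice the side (`exists_used`). So the tripled interval leaves the
domain, or the second difference of `f` changes sign in it and has a real root there. The second
difference is a polynomial of degree at most `d`, hence each level has only O(d) such diagonals
(`card_used_le`). A used diagonal consists of about n/w squares and costs O(n log n). Over all
levels this gives O(d n log² n), which is below the required bound because σ ≥ 1
(`nearly_linear_le_bound`).

Goodness of an interval is tested in constant time, with prefix counts of the strictly convex and
the strictly concave positions. Correctness has two halves: a cell of the result is only ever
lowered to some `a (k + i) + F i` (`Refines`), and in the end it is below all of them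
(`le_of_belowLevel`). Every computed number is an integer bounded by `intBound`, or one entry of `a`
plus such an integer, so denominators never grow. -/

namespace RealRAM

-- Program logic: frame rule and weakest preconditions with running time.

infixr:60 " ;; " => Cmd.seq

@[simp]
theorem State.setReg_reg (s : State) (x y : ℕ) (v : ℝ) :
    (s.setReg x v).reg y = if y = x then v else s.reg y := by
  simp [State.setReg, Function.update_apply]

@[simp]
theorem State.setReg_arr (s : State) (x : ℕ) (v : ℝ) : (s.setReg x v).arr = s.arr := rfl

@[simp]
theorem State.setArr_reg (s : State) (A k : ℕ) (v : ℝ) : (s.setArr A k v).reg = s.reg := rfl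

@[simp]
theorem State.setArr_arr (s : State) (A B k : ℕ) (v : ℝ) :
    (s.setArr A k v).arr B = if B = A then Function.update (s.arr A) k v else s.arr B := by
  simp [State.setArr, Function.update_apply]

@[simp] theorem ArithOp.eval_add (u v : ℝ) : ArithOp.add.eval u v = u + v := rfl
@[simp] theorem ArithOp.eval_sub (u v : ℝ) : ArithOp.sub.eval u v = u - v := rfl
@[simp] theorem ArithOp.eval_mul (u v : ℝ) : ArithOp.mul.eval u v = u * v := rfl

/-- Whether the text of the program contains an assignment to the register `x`. -/
def Cmd.writesReg : Cmd → ℕ → Bool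
  | .skip, _ => false
  | .const y _, x => x == y
  | .arith _ y _ _, x => x == y
  | .load y _ _, x => x == y
  | .store _ _ _, _ => false
  | .seq P Q, x => P.writesReg x || Q.writesReg x
  | .ifLt _ _ P Q, x => P.writesReg x || Q.writesReg x
  | .whileLt _ _ P, x => P.writesReg x

/-- Whether the text of the program contains an assignment to a cell of the array `A`. -/
def Cmd.writesArr : Cmd → ℕ → Bool
  | .skip, _ => false
  | .const _ _, _ => false
  | .arith _ _ _ _, _ => false
  | .load _ _ _, _ => false
  | .store B _ _, A => A == B
  | .seq P Q, A => P.writesArr A || Q.writesArr A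
  | .ifLt _ _ P Q, A => P.writesArr A || Q.writesArr A
  | .whileLt _ _ P, A => P.writesArr A

/-- `s` and `s'` differ only in registers and arrays to which `P` may write. -/
structure Agree (P : Cmd) (s s' : State) : Prop where
  reg : ∀ x, P.writesReg x = false → s'.reg x = s.reg x
  arr : ∀ A, P.writesArr A = false → s'.arr A = s.arr A

theorem Agree.refl (P : Cmd) (s : State) : Agree P s s := ⟨fun _ _ => rfl, fun _ _ => rfl⟩

theorem Agree.trans {P : Cmd} {s s' s'' : State} (h : Agree P s s') (h' : Agree P s' s'') :
    Agree P s s'' :=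
  ⟨fun x hx => (h'.reg x hx).trans (h.reg x hx), fun A hA => (h'.arr A hA).trans (h.arr A hA)⟩

/-- The frame rule. Since `Cmd.writesReg` and `Cmd.writesArr` are computable, its side conditions
are later settled by `rfl` or `decide`. -/
theorem Exec.agree {V : ℝ → Prop} {P : Cmd} {s s' : State} {t : ℕ} (h : Exec V P s t s') :
    Agree P s s' := by
  induction h with
  | skip | whileFalse => exact Agree.refl _ _
  | const | arith | load | store => constructor <;> intro x hx <;> simp_all [Cmd.writesReg, Cmd.writesArr]
  | seq P Q s s' s'' t t' hP hQ ihP ihQ =>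
    refine ⟨fun x hx => ?_, fun A hA => ?_⟩
    · simp only [Cmd.writesReg, Bool.or_eq_false_iff] at hx
      rw [ihQ.reg x hx.2, ihP.reg x hx.1]
    · simp only [Cmd.writesArr, Bool.or_eq_false_iff] at hA
      rw [ihQ.arr A hA.2, ihP.arr A hA.1]
  | ifTrue x y P Q s s' t h hP ih =>
    refine ⟨fun x hx => ih.reg x ?_, fun A hA => ih.arr A ?_⟩
    · simp only [Cmd.writesReg, Bool.or_eq_false_iff] at hx; exact hx.1
    · simp only [Cmd.writesArr, Bool.or_eq_false_iff] at hA; exact hA.1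
  | ifFalse x y P Q s s' t h hP ih =>
    refine ⟨fun x hx => ih.reg x ?_, fun A hA => ih.arr A ?_⟩
    · simp only [Cmd.writesReg, Bool.or_eq_false_iff] at hx; exact hx.2
    · simp only [Cmd.writesArr, Bool.or_eq_false_iff] at hA; exact hA.2
  | whileTrue x y P s s' s'' t t' h hP hW ihP ihW =>
    exact Agree.trans (s' := s') ⟨ihP.reg, ihP.arr⟩ ihW

/-- The weakest precondition: `P` terminates from `s`, with a running time and a final state that
satisfy `R`. -/
def wp (V : ℝ → Prop) (P : Cmd) (s : State) (R : ℕ → State → Prop) : Prop :=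
  ∃ t s', Exec V P s t s' ∧ R t s'

section Rules

variable {V : ℝ → Prop} {P Q : Cmd} {s : State} {R R' : ℕ → State → Prop}

theorem wp.mono (h : wp V P s R) (hR : ∀ t s', Agree P s s' → R t s' → R' t s') :
    wp V P s R' :=
  let ⟨t, s', hE, h'⟩ := h
  ⟨t, s', hE, hR t s' hE.agree h'⟩

theorem wp_skip (h : R 1 s) : wp V .skip s R := ⟨_, _, .skip s, h⟩

theorem wp_const {x : ℕ} {c : ℤ} (hV : V c) (h : R 1 (s.setReg x c)) : wp V (.const x c) s R :=
  ⟨_, _, .const s x c hV, h⟩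

theorem wp_arith {o : ArithOp} {x y z : ℕ} (v : ℝ) (hv : o.eval (s.reg y) (s.reg z) = v) (hV : V v)
    (h : R 1 (s.setReg x v)) : wp V (.arith o x y z) s R := by
  subst hv
  exact ⟨_, _, .arith s o x y z hV, h⟩

theorem wp_load {x A y : ℕ} (k : ℕ) (hk : s.reg y = k) (h : R 1 (s.setReg x (s.arr A k))) :
    wp V (.load x A y) s R :=
  ⟨_, _, .load s x A y k hk, h⟩

theorem wp_store {x A y : ℕ} (k : ℕ) (hk : s.reg y = k) (h : R 1 (s.setArr A k (s.reg x))) :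
    wp V (.store A y x) s R :=
  ⟨_, _, .store s A y x k hk, h⟩

theorem wp_seq (h : wp V P s fun t s' => wp V Q s' fun t' s'' => R (t + t') s'') :
    wp V (P ;; Q) s R :=
  let ⟨t, s', hP, t', s'', hQ, hR⟩ := h
  ⟨t + t', s'', .seq P Q s s' s'' t t' hP hQ, hR⟩

theorem wp_ifLt {x y : ℕ} (ht : s.reg x < s.reg y → wp V P s fun t s' => R (t + 1) s')
    (hf : ¬ s.reg x < s.reg y → wp V Q s fun t s' => R (t + 1) s') :
    wp V (.ifLt x y P Q) s R := by
  by_cases h : s.reg x < s.reg y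
  · obtain ⟨t, s', hE, hR⟩ := ht h
    exact ⟨_, _, .ifTrue x y P Q s s' t h hE, hR⟩
  · obtain ⟨t, s', hE, hR⟩ := hf h
    exact ⟨_, _, .ifFalse x y P Q s s' t h hE, hR⟩

/-- A loop that runs for `N` rounds, with the invariant `I i` before the round `i` and at most
`T i` steps in the body of this round. -/
theorem wp_whileLt {x y : ℕ} (N : ℕ) (I : ℕ → State → Prop) (T : ℕ → ℕ) (h0 : I 0 s)
    (hstep : ∀ i < N, ∀ s', Agree P s s' → I i s' →
      s'.reg x < s'.reg y ∧ wp V P s' fun t s'' => t ≤ T i ∧ I (i + 1) s'')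
    (hend : ∀ s', Agree P s s' → I N s' → ¬ s'.reg x < s'.reg y)
    (hR : ∀ t s', Agree P s s' → t ≤ ∑ i ∈ Finset.range N, (T i + 1) + 1 → I N s' → R t s') :
    wp V (.whileLt x y P) s R := by
  -- Induction on the number `k` of rounds that remain, so that the cost of the current round is the
  -- first term of the sum.
  have key : ∀ k ≤ N, ∀ s', Agree P s s' → I (N - k) s' →
      ∃ t s'', Exec V (.whileLt x y P) s' t s'' ∧
        t ≤ ∑ i ∈ Finset.Ico (N - k) N, (T i + 1) + 1 ∧ I N s'' ∧ Agree P s s'' := by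
    intro k
    induction k with
    | zero =>
      intro _ s' hA hI
      exact ⟨1, s', .whileFalse x y P s' (hend s' hA hI), by simp, hI, hA⟩
    | succ k ih =>
      intro hk s' hA hI
      obtain ⟨hlt, t, s'', hE, ht, hI'⟩ := hstep (N - (k + 1)) (by omega) s' hA hI
      have e : N - (k + 1) + 1 = N - k := by omega
      rw [e] at hI'
      obtain ⟨t', s3, hE', ht', hI3, hA3⟩ := ih (by omega) s'' (hA.trans hE.agree) hI'
      refine ⟨_, s3, .whileTrue x y P s' s'' s3 t t' hlt hE hE', ?_, hI3, hA3⟩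
      rw [Finset.sum_eq_sum_Ico_succ_bot (by omega), e]
      omega
  obtain ⟨t, s', hE, ht, hI, hA⟩ := key N le_rfl s (Agree.refl _ _) (by simpa using h0)
  refine ⟨t, s', hE, hR t s' hA ?_ hI⟩
  rwa [Nat.sub_self, ← Finset.range_eq_Ico] at ht

end Rules

end RealRAM

/-! ### Discrete convexity and the dyadic cover of the band. -/

namespace MinConv

open RealRAM

/-- The second differences of `F` are nonnegative between `lo` and `hi`. -/
def DiscreteConvex (F : ℕ → ℝ) (lo hi : ℤ) : Prop :=
  ∀ t : ℕ, lo ≤ t → (t : ℤ) + 2 ≤ hi → F (t + 1) + F (t + 1) ≤ F t + F (t + 2)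

/-- The second differences of `F` are nonpositive between `lo` and `hi`. -/
def DiscreteConcave (F : ℕ → ℝ) (lo hi : ℤ) : Prop :=
  ∀ t : ℕ, lo ≤ t → (t : ℤ) + 2 ≤ hi → F t + F (t + 2) ≤ F (t + 1) + F (t + 1)

/-- Increments of a convex sequence over a fixed step grow with the starting point. This is the
source of the Monge inequality for the matrix `F (j - k)`. -/
theorem DiscreteConvex.exchange {F : ℕ → ℝ} {lo hi : ℤ} (h : DiscreteConvex F lo hi) {x y p : ℕ}
    (hx : lo ≤ x) (hxy : x ≤ y) (hy : (y : ℤ) + p ≤ hi) :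
    F (x + p) + F y ≤ F x + F (y + p) := by
  have key : ∀ k u : ℕ, lo ≤ u → (u : ℤ) + k + 1 ≤ hi →
      F (u + 1) + F (u + k) ≤ F u + F (u + k + 1) := by
    intro k u hu
    induction k with
    | zero => intro _; simp [add_comm]
    | succ k ih =>
      intro hk
      have h1 := ih (by push_cast at hk; omega)
      have h2 := h (u + k) (by push_cast; omega) (by push_cast at hk ⊢; omega)
      rw [show u + (k + 1) = u + k + 1 from rfl, show u + k + 1 + 1 = u + k + 2 from rfl]
      linarith
  induction p with
  | zero => simp
  | succ p ih =>
    have h1 := ih (by push_cast at hy; omega)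
    have h2 := key (y - x) (x + p) (by push_cast; omega) (by push_cast at hy ⊢; omega)
    rw [show x + p + (y - x) = y + p by omega] at h2
    rw [← add_assoc, ← add_assoc]
    linarith

theorem DiscreteConcave.exchange {F : ℕ → ℝ} {lo hi : ℤ} (h : DiscreteConcave F lo hi)
    {x y p : ℕ} (hx : lo ≤ x) (hxy : x ≤ y) (hy : (y : ℤ) + p ≤ hi) :
    F x + F (y + p) ≤ F (x + p) + F y := by
  have h' : DiscreteConvex (-F) lo hi := fun t h1 h2 => by
    have := h t h1 h2
    simp only [Pi.neg_apply]; linarith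
  have := h'.exchange hx hxy hy
  simp only [Pi.neg_apply] at this
  linarith

/-- The interval from `lo` to `hi` lies in the domain `{0, …, m - 1}` of `F`, and `F` is convex or
concave on it. -/
def Good (F : ℕ → ℝ) (m : ℕ) (lo hi : ℤ) : Prop :=
  0 ≤ lo ∧ hi < m ∧ (DiscreteConcave F lo hi ∨ DiscreteConvex F lo hi)

theorem Good.mono {F : ℕ → ℝ} {m : ℕ} {lo hi lo' hi' : ℤ} (h : Good F m lo hi) (hlo : lo ≤ lo')
    (hhi : hi' ≤ hi) : Good F m lo' hi' :=
  ⟨h.1.trans hlo, hhi.trans_lt h.2.1,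
    h.2.2.imp (fun h t h1 h2 => h t (hlo.trans h1) (h2.trans hhi))
      (fun h t h1 h2 => h t (hlo.trans h1) (h2.trans hhi))⟩

/-- The squares of side `w` around the diagonal `j - k = e` are good, but the ones with three times
the radius are not. -/
def Used (F : ℕ → ℝ) (m w e : ℕ) : Prop :=
  Good F m ((e : ℤ) - w + 1) ((e : ℤ) + w - 1) ∧
    ¬ Good F m ((e : ℤ) - 3 * w + 1) ((e : ℤ) + 3 * w - 1)

theorem exists_used (F : ℕ → ℝ) {m i : ℕ} (hi : i < m) (k : ℕ) :
    ∃ s : ℕ, 2 ^ s ≤ m ∧ Used F m (2 ^ s) (((k + i) / 2 ^ s - k / 2 ^ s) * 2 ^ s) := by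
  classical
  let D : ℕ → ℕ := fun s => (k + i) / 2 ^ s - k / 2 ^ s
  let G : ℕ → Prop := fun s => 2 ^ s ≤ m ∧
    Good F m (((D s * 2 ^ s : ℕ) : ℤ) - (2 ^ s : ℕ) + 1) (((D s * 2 ^ s : ℕ) : ℤ) + (2 ^ s : ℕ) - 1)
  have hD : ∀ s, D s + k / 2 ^ s = (k + i) / 2 ^ s := fun s =>
    Nat.sub_add_cancel (Nat.div_le_div_right (Nat.le_add_right _ _))
  -- A single cell is always good: an interval of one point contains no second difference.
  have hG0 : G 0 := by
    refine ⟨by simp; omega, ?_, ?_, Or.inl fun t h1 h2 => ?_⟩ <;> simp [D] at * <;> omega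
  have hm : ∀ s, G s → s ≤ m := fun s hs => (Nat.lt_two_pow_self.le).trans hs.1
  set s := Nat.findGreatest G m with hs
  have hGs : G s := Nat.findGreatest_spec (Nat.zero_le m) hG0
  refine ⟨s, hGs.1, hGs.2, fun hbad => ?_⟩
  have hpow : 2 ^ (s + 1) = 2 * 2 ^ s := by ring
  have hw : 0 < 2 ^ s := by positivity
  change Good F m (((D s * 2 ^ s : ℕ) : ℤ) - 3 * (2 ^ s : ℕ) + 1)
    (((D s * 2 ^ s : ℕ) : ℤ) + 3 * (2 ^ s : ℕ) - 1) at hbad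
  -- Rounding both block indices to even numbers changes their difference by at most one. Hence the
  -- centres at the two levels differ by at most `2 ^ s`, and radius `2 * 2 ^ s` around the new
  -- centre fits into radius `3 * 2 ^ s` around the old one.
  have hDD : D s ≤ 2 * D (s + 1) + 1 ∧ 2 * D (s + 1) ≤ D s + 1 := by
    have h1 := hD s
    have h2 := hD (s + 1)
    rw [pow_succ, ← Nat.div_div_eq_div_mul, ← Nat.div_div_eq_div_mul] at h2
    omega
  have hGs1 : G (s + 1) := by
    have e : D (s + 1) * 2 ^ (s + 1) = 2 * D (s + 1) * 2 ^ s := by rw [hpow]; ring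
    have b1 : D s * 2 ^ s ≤ 2 * D (s + 1) * 2 ^ s + 2 ^ s := by
      calc _ ≤ (2 * D (s + 1) + 1) * 2 ^ s := Nat.mul_le_mul_right _ hDD.1
        _ = _ := by ring
    have b2 : 2 * D (s + 1) * 2 ^ s ≤ D s * 2 ^ s + 2 ^ s := by
      calc _ ≤ (D s + 1) * 2 ^ s := Nat.mul_le_mul_right _ hDD.2
        _ = _ := by ring
    refine ⟨?_, hbad.mono ?_ ?_⟩
    · have h1 := hbad.1
      have h2 := hbad.2.1
      omega
    · rw [e, hpow]; omega
    · rw [e, hpow]; omega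
  exact absurd (Nat.le_findGreatest (hm _ hGs1) hGs1) (by omega)

/-! ### Row minima of Monge matrices by successive halving of strides. -/

/-- The columns `O 0 ≤ O h ≤ O (2 * h) ≤ …` delimit the positions of the row minima of `val`. -/
structure Bracket (val : ℕ → ℕ → ℝ) (w h M : ℕ) (O : ℕ → ℕ) : Prop where
  zero : O 0 = 0
  mono : ∀ i < M, O (i * h) ≤ O ((i + 1) * h)
  lt : ∀ i ≤ M, O (i * h) < w
  cover : ∀ i < M, ∀ r, 1 ≤ r → r ≤ w → i * h ≤ r → r ≤ (i + 1) * h → ∀ c < w,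
    ∃ c', O (i * h) ≤ c' ∧ c' ≤ O ((i + 1) * h) ∧ val r c' ≤ val r c

/-- The Monge inequality for a `w × w` matrix with rows `1, …, w` and columns `0, …, w - 1`. -/
def Monge (val : ℕ → ℕ → ℝ) (w : ℕ) : Prop :=
  ∀ r r' c c', 1 ≤ r → r ≤ r' → r' ≤ w → c ≤ c' → c' < w →
    val r c + val r' c' ≤ val r c' + val r' c

/-- The rows `0` and `2 * w` are fictitious. Assigning the extreme columns to them gives a bracket
that excludes nothing. -/
theorem Bracket.init {val : ℕ → ℕ → ℝ} {w : ℕ} (hw : 0 < w) {O : ℕ → ℕ} (h0 : O 0 = 0)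
    (h2 : O (2 * w) = w - 1) : Bracket val w (2 * w) 1 O where
  zero := h0
  mono i hi := by
    obtain rfl : i = 0 := by omega
    simp [h0]
  lt i hi := by
    obtain rfl | rfl : i = 0 ∨ i = 1 := by omega
    · simp [h0, hw]
    · simp [h2, hw]
  cover i hi r _ _ _ _ c hc := by
    obtain rfl : i = 0 := by omega
    exact ⟨c, by simp [h0], by simp [h2]; omega, le_rfl⟩

theorem Bracket.weaken {val : ℕ → ℕ → ℝ} {w h M M' : ℕ} {O : ℕ → ℕ} (hb : Bracket val w h M O)
    (hM : M' ≤ M) : Bracket val w h M' O :=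
  ⟨hb.zero, fun i hi => hb.mono i (by omega), fun i hi => hb.lt i (by omega),
    fun i hi => hb.cover i (by omega)⟩

/-- A minimum within the bracket of its row is a minimum of the row. -/
theorem Bracket.isMin {val : ℕ → ℕ → ℝ} {w h M : ℕ} {O : ℕ → ℕ} (hb : Bracket val w h M O)
    {i r p : ℕ} (hi : i < M) (hr1 : 1 ≤ r) (hrw : r ≤ w) (h1 : i * h ≤ r) (h2 : r ≤ (i + 1) * h)
    (hp : ∀ c, O (i * h) ≤ c → c ≤ O ((i + 1) * h) → val r p ≤ val r c) :
    ∀ c < w, val r p ≤ val r c := fun c hc =>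
  let ⟨_, ha, hb', hle⟩ := hb.cover i hi r hr1 hrw h1 h2 c hc
  (hp _ ha hb').trans hle

/-- Let `p` be the position of the minimum in an odd row. By the Monge inequality a row above it
gains nothing to the right of `p`, and a row below it nothing to the left. So a column of the coarse
bracket on the wrong side of `p` can be replaced by `p`. -/
theorem Bracket.refine {val : ℕ → ℕ → ℝ} {w h M : ℕ} {O O' : ℕ → ℕ}
    (hb : Bracket val w (2 * h) M O) (hM : Monge val w) (hh : 0 < h)
    (hle : ∀ i < M, (2 * i + 1) * h ≤ w)
    (heven : ∀ i ≤ M, O' (i * (2 * h)) = O (i * (2 * h)))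
    (hodd : ∀ i < M, O (i * (2 * h)) ≤ O' ((2 * i + 1) * h) ∧
      O' ((2 * i + 1) * h) ≤ O ((i + 1) * (2 * h)) ∧
      ∀ c < w, val ((2 * i + 1) * h) (O' ((2 * i + 1) * h)) ≤ val ((2 * i + 1) * h) c) :
    Bracket val w h (2 * M) O' := by
  have e0 : ∀ i, (2 * i) * h = i * (2 * h) := fun i => by ring
  have e2 : ∀ i, (2 * i + 1 + 1) * h = (i + 1) * (2 * h) := fun i => by ring
  refine ⟨?_, ?_, ?_, ?_⟩
  · simpa [hb.zero] using heven 0 (Nat.zero_le _)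
  · intro i hi
    obtain ⟨j, rfl | rfl⟩ := Nat.even_or_odd' i
    · rw [e0, heven j (by omega)]; exact (hodd j (by omega)).1
    · rw [e2, heven (j + 1) (by omega)]; exact (hodd j (by omega)).2.1
  · intro i hi
    obtain ⟨j, rfl | rfl⟩ := Nat.even_or_odd' i
    · rw [e0, heven j (by omega)]; exact hb.lt j (by omega)
    · exact (hodd j (by omega)).2.1.trans_lt (hb.lt (j + 1) (by omega))
  · intro i hi r hr1 hrw h1 h2 c hc
    obtain ⟨j, rfl | rfl⟩ := Nat.even_or_odd' i
    · have hj : j < M := by omega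
      obtain ⟨ho1, ho2, ho3⟩ := hodd j hj
      rw [e0] at h1 ⊢
      rw [heven j hj.le]
      obtain ⟨c', ha, hb', hv⟩ := hb.cover j hj r hr1 hrw h1
        (h2.trans (by rw [← e2]; exact Nat.mul_le_mul_right _ (Nat.le_succ _))) c hc
      rcases le_total c' (O' ((2 * j + 1) * h)) with hcc | hcc
      · exact ⟨c', ha, hcc, hv⟩
      · refine ⟨_, ho1, le_rfl, le_trans ?_ hv⟩
        have hc'w := hb'.trans_lt (hb.lt (j + 1) (by omega))
        have := hM r _ _ c' hr1 h2 (hle j hj) hcc hc'w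
        have := ho3 c' hc'w
        linarith
    · have hj : j < M := by omega
      obtain ⟨ho1, ho2, ho3⟩ := hodd j hj
      rw [e2] at h2 ⊢
      rw [heven (j + 1) (by omega)]
      obtain ⟨c', ha, hb', hv⟩ := hb.cover j hj r hr1 hrw
        (le_trans (by rw [← e0]; exact Nat.mul_le_mul_right _ (Nat.le_succ _)) h1) h2 c hc
      rcases le_total (O' ((2 * j + 1) * h)) c' with hcc | hcc
      · exact ⟨c', hcc, hb', hv⟩
      · refine ⟨_, le_rfl, ho2, le_trans ?_ hv⟩
        have h0 : 1 ≤ (2 * j + 1) * h := Nat.mul_pos (by omega) hh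
        have := hM _ r c' _ h0 h1 hrw hcc (ho2.trans_lt (hb.lt (j + 1) (by omega)))
        have := ho3 c' (hb'.trans_lt (hb.lt (j + 1) (by omega)))
        linarith

/-! ### The number of used diagonals. -/

open Polynomial in
/-- Only boundedly many diagonals per root of the second difference are used. -/
theorem card_used_le {f : Polynomial ℤ} {d : ℕ} (hd : 1 ≤ d) (hf : f.natDegree ≤ d) {F : ℕ → ℝ}
    {m : ℕ} (hF : ∀ i < m, F i = (f.eval (i : ℤ) : ℤ)) {w : ℕ} (hw : 0 < w) (S : Finset ℕ)
    (hS : ∀ D ∈ S, Used F m w (D * w)) : S.card ≤ 12 * d := by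
  classical
  let p : ℝ[X] := f.map (Int.castRingHom ℝ)
  have hp : p.natDegree ≤ d := natDegree_map_le.trans hf
  have hpF : ∀ i < m, F i = p.eval (i : ℝ) := fun i hi => by
    rw [hF i hi]
    simp only [p, ← Int.cast_natCast (R := ℝ) i, eval_intCast_map, eq_intCast]
    norm_cast
  -- The second difference as a real polynomial. The crude degree bound `d` is enough.
  let g : ℝ[X] := (taylor 2 p + p) - (taylor 1 p + taylor 1 p)
  have hg : g.natDegree ≤ d := by
    have h1 : (taylor 1 p).natDegree ≤ d := by rwa [natDegree_taylor]
    have h2 : (taylor 2 p).natDegree ≤ d := by rwa [natDegree_taylor]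
    exact (natDegree_sub_le_of_le (natDegree_add_le_of_degree_le h2 hp)
      (natDegree_add_le_of_degree_le h1 h1)).trans (max_self d).le
  have hgF : ∀ t : ℕ, t + 2 < m → g.eval (t : ℝ) = F t + F (t + 2) - (F (t + 1) + F (t + 1)) := by
    intro t ht
    rw [hpF t (by omega), hpF (t + 1) (by omega), hpF (t + 2) ht]
    simp [g, taylor_eval]
    ring
  -- The tripled interval sticks out on the left (only if `D < 3`), or on the right (at most three
  -- values of `D`), or it contains a root `x` of `g` with `|x - D * w| < 3 * w`, which leaves at
  -- most six values of `D` per root. In total `6 + 6 * d ≤ 12 * d`.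
  have hsub : S ⊆ Finset.range 3 ∪ Finset.Icc ((m - 1) / w - 2) ((m - 1) / w) ∪
      g.roots.toFinset.biUnion fun x => Finset.Icc (⌈x / w⌉₊ - 3) (⌈x / w⌉₊ + 2) := by
    intro D hD
    obtain ⟨⟨hg1, hg2, -⟩, hbad⟩ := hS D hD
    simp only [Finset.mem_union, Finset.mem_range, Finset.mem_Icc, Finset.mem_biUnion]
    by_cases hD3 : D < 3
    · exact Or.inl (Or.inl hD3)
    have h3w : 3 * w ≤ D * w := Nat.mul_le_mul_right _ (by omega)
    by_cases hhi : m ≤ D * w + 3 * w - 1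
    · left; right
      have h1 : D ≤ (m - 1) / w := (Nat.le_div_iff_mul_le hw).2 (by push_cast at hg2; omega)
      have h2 : (m - 1) / w < D + 3 := (Nat.div_lt_iff_lt_mul hw).2 (by rw [add_mul]; omega)
      omega
    right
    have hin : ∀ t : ℕ, ((D * w : ℕ) : ℤ) - 3 * w + 1 ≤ t →
        (t : ℤ) + 2 ≤ ((D * w : ℕ) : ℤ) + 3 * w - 1 →
        t + 2 < m ∧ (D : ℝ) * w - 3 * w < t ∧ (t : ℝ) < D * w + 3 * w := by
      intro t h1 h2
      refine ⟨by omega, ?_, ?_⟩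
      · have : ((D * w : ℕ) : ℤ) - 3 * w < t := by omega
        exact_mod_cast this
      · have : (t : ℤ) < ((D * w : ℕ) : ℤ) + 3 * w := by omega
        exact_mod_cast this
    have hn : ¬ (DiscreteConcave F (((D * w : ℕ) : ℤ) - 3 * w + 1) (((D * w : ℕ) : ℤ) + 3 * w - 1) ∨
        DiscreteConvex F (((D * w : ℕ) : ℤ) - 3 * w + 1) (((D * w : ℕ) : ℤ) + 3 * w - 1)) :=
      fun h => hbad ⟨by omega, by omega, h⟩
    simp only [DiscreteConcave, DiscreteConvex, not_or, not_forall, not_le] at hn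
    obtain ⟨⟨t, ht1, ht2, ht⟩, t', ht1', ht2', ht'⟩ := hn
    obtain ⟨htm, hlo, hhi⟩ := hin t ht1 ht2
    obtain ⟨htm', hlo', hhi'⟩ := hin t' ht1' ht2'
    have hgt : 0 < g.eval (t : ℝ) := by rw [hgF t htm]; linarith
    have hgt' : g.eval (t' : ℝ) < 0 := by rw [hgF t' htm']; linarith
    -- The order of `t` and `t'` is unknown, hence the unordered interval.
    obtain ⟨x, hx, hx0⟩ := intermediate_value_uIcc (f := fun x => g.eval x)
      (a := (t' : ℝ)) (b := (t : ℝ)) g.continuous.continuousOn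
      (Set.Icc_subset_uIcc ⟨hgt'.le, hgt.le⟩)
    have hg0 : g ≠ 0 := by rintro h; simp [h] at hgt
    refine ⟨x, by simpa [hg0] using hx0, ?_⟩
    have hw' : (0 : ℝ) < w := by exact_mod_cast hw
    have hxl : (D : ℝ) * w - 3 * w < x := lt_of_lt_of_le (lt_min hlo' hlo) hx.1
    have hxr : x < D * w + 3 * w := lt_of_le_of_lt hx.2 (max_lt hhi' hhi)
    have h1 : ⌈x / w⌉₊ ≤ D + 3 := by
      rw [Nat.ceil_le, div_le_iff₀ hw']; push_cast; linarith
    have h2 : D < ⌈x / w⌉₊ + 3 := by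
      have : (D : ℝ) < x / w + 3 := by
        rw [← sub_lt_iff_lt_add, lt_div_iff₀ hw']; linarith
      exact_mod_cast this.trans_le (add_le_add_left (Nat.le_ceil _) _)
    omega
  refine (Finset.card_le_card hsub).trans ?_
  have hr : g.roots.toFinset.card ≤ d :=
    (Multiset.toFinset_card_le _).trans ((card_roots' g).trans hg)
  have h3 : (g.roots.toFinset.biUnion fun x : ℝ => Finset.Icc (⌈x / w⌉₊ - 3) (⌈x / w⌉₊ + 2)).card ≤
      d * 6 := by
    refine (Finset.card_biUnion_le_card_mul _ _ 6 fun x _ => ?_).trans (Nat.mul_le_mul_right _ hr)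
    rw [Nat.card_Icc]; omega
  have h1 := Finset.card_union_le (Finset.range 3 ∪ Finset.Icc ((m - 1) / w - 2) ((m - 1) / w))
    (g.roots.toFinset.biUnion fun x : ℝ => Finset.Icc (⌈x / w⌉₊ - 3) (⌈x / w⌉₊ + 2))
  have h2 := Finset.card_union_le (Finset.range 3) (Finset.Icc ((m - 1) / w - 2) ((m - 1) / w))
  rw [Finset.card_range, Nat.card_Icc] at h2
  omega

/-! ### Squares of the band as Monge matrices. -/

/-- The increasing and the decreasing enumeration of the columns of a square. -/
def column (convex : Prop) [Decidable convex] (j w c : ℕ) : ℕ :=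
  if convex then j + c else j + (w - 1 - c)

/-- The terms of `A` cancel in the Monge inequality; what remains is the exchange inequality for
`F`. In the concave case that inequality is reversed, and the reversed column order restores its
direction. -/
theorem monge_column {F A : ℕ → ℝ} {lo hi : ℤ} {e w k : ℕ} (convex : Prop) [Decidable convex]
    (hlo : lo = (e : ℤ) - w + 1) (hhi : hi = (e : ℤ) + w - 1) (h0 : 0 ≤ lo)
    (hF : if convex then DiscreteConvex F lo hi else DiscreteConcave F lo hi) :
    Monge (fun r c => A (column convex (k + e) w c) +
      F (column convex (k + e) w c - (k + r - 1))) w := by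
  intro r r' c c' hr hrr hrw hcc hcw
  subst hlo hhi
  by_cases h : convex
  · simp only [h, column, if_true] at hF ⊢
    have := hF.exchange (x := k + e + c - (k + r' - 1)) (y := k + e + c - (k + r - 1)) (p := c' - c)
      (by omega) (by omega) (by omega)
    rw [show k + e + c - (k + r' - 1) + (c' - c) = k + e + c' - (k + r' - 1) by omega,
      show k + e + c - (k + r - 1) + (c' - c) = k + e + c' - (k + r - 1) by omega] at this
    linarith
  · simp only [h, column, if_false] at hF ⊢
    have := hF.exchange (x := k + e + (w - 1 - c') - (k + r' - 1))
      (y := k + e + (w - 1 - c') - (k + r - 1)) (p := c' - c)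
      (by omega) (by omega) (by omega)
    rw [show k + e + (w - 1 - c') - (k + r' - 1) + (c' - c) =
        k + e + (w - 1 - c) - (k + r' - 1) by omega,
      show k + e + (w - 1 - c') - (k + r - 1) + (c' - c) =
        k + e + (w - 1 - c) - (k + r - 1) by omega] at this
    linarith

/-! ### Bit sizes of the computed values. -/

section Size

/-- A bound for the integers that occur in the computation. -/
def intBound (d n : ℕ) (f : Polynomial ℤ) : ℕ :=
  16 * (∑ j ∈ Finset.range (d + 1), (f.coeff j).natAbs + 1) * n ^ (d + 1)

/-- Rests on `x + y < (x + 1) * (y + 1)`. -/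
theorem sum_lt_two_pow {ι : Type*} (S : Finset ι) (g h : ι → ℕ) (hg : ∀ i ∈ S, g i < 2 ^ h i) :
    ∑ i ∈ S, g i < 2 ^ ∑ i ∈ S, h i := by
  classical
  induction S using Finset.induction_on with
  | empty => simp
  | insert i S hi ih =>
    rw [Finset.sum_insert hi, Finset.sum_insert hi, pow_add]
    have h1 := hg i (by simp)
    have h2 := ih fun j hj => hg j (by simp [hj])
    nlinarith [Nat.mul_le_mul (Nat.le_add_left 1 (g i)) (Nat.le_add_left 1 (∑ i ∈ S, g i)),
      Nat.mul_le_mul (Nat.succ_le_of_lt h1) (Nat.succ_le_of_lt h2),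
      Nat.zero_le (g i * ∑ i ∈ S, g i)]

/-- Each of the `d + 1` coefficients, even a zero, adds at least one to the input size `L`. So `d +
1 ≤ L`, and the power `n ^ (d + 1)` has at most about `L ^ 2` bits. -/
theorem intBound_lt (d n m : ℕ) (hd : 1 ≤ d) (f : Polynomial ℤ) (q : Fin n → ℚ) :
    intBound d n f < 2 ^ (8 * inputSize d n m f q ^ 2) := by
  set L := inputSize d n m f q with hL
  have hc : ∑ j ∈ Finset.range (d + 1), (f.coeff j).natAbs <
      2 ^ ∑ j ∈ Finset.range (d + 1), ratSize (f.coeff j : ℚ) := by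
    refine sum_lt_two_pow _ _ _ fun j _ => ?_
    refine Nat.lt_size_self _ |>.trans_le (Nat.pow_le_pow_right (by norm_num) ?_)
    simp only [ratSize, Rat.num_intCast]; omega
  have hn : n < 2 ^ ratSize (n : ℚ) := by
    refine Nat.lt_size_self _ |>.trans_le (Nat.pow_le_pow_right (by norm_num) ?_)
    simp only [ratSize, Rat.num_natCast, Int.natAbs_natCast]; omega
  have hdL : d + 1 ≤ ∑ j ∈ Finset.range (d + 1), ratSize (f.coeff j : ℚ) := by
    have := Finset.card_nsmul_le_sum (Finset.range (d + 1)) (fun j => ratSize (f.coeff j : ℚ)) 1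
      (fun j _ => by simp only [ratSize]; omega)
    simpa using this
  have hnL : ratSize (n : ℚ) ≤ L := by rw [hL, inputSize]; omega
  have hcL : ∑ j ∈ Finset.range (d + 1), ratSize (f.coeff j : ℚ) ≤ L := by rw [hL, inputSize]; omega
  have hL1 : 1 ≤ L := by omega
  calc intBound d n f ≤ 2 ^ 4 * 2 ^ L * n ^ (d + 1) := by
        rw [intBound]
        refine Nat.mul_le_mul_right _ (Nat.mul_le_mul_left _ ?_)
        exact hc.trans_le (Nat.pow_le_pow_right (by norm_num) hcL)
    _ ≤ 2 ^ 4 * 2 ^ L * (2 ^ L) ^ L := by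
        refine Nat.mul_le_mul_left _ ?_
        exact (Nat.pow_le_pow_left (hn.le.trans (Nat.pow_le_pow_right (by norm_num) hnL)) _).trans
          (Nat.pow_le_pow_right (by positivity) (hdL.trans hcL))
    _ = 2 ^ (4 + L + L * L) := by rw [← pow_mul, ← pow_add, ← pow_add]
    _ < 2 ^ (8 * L ^ 2) := Nat.pow_lt_pow_right (by norm_num) (by nlinarith)

/-- Adding an integer keeps the denominator; the numerator changes by `z` times it. -/
theorem ratSize_add_intCast_le {q : ℚ} {z : ℤ} {N : ℕ} (hz : z.natAbs < 2 ^ N) :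
    ratSize (q + z) ≤ 2 * ratSize q + N := by
  have hden : (q + z).den = q.den := Rat.add_intCast_den q z
  have hnum : (q + z).num = q.num + z * q.den := by
    have h := Rat.mul_den_eq_num (q + z)
    rw [hden, add_mul, Rat.mul_den_eq_num] at h
    exact_mod_cast h.symm
  have h1 : ((q + z).num).natAbs < 2 ^ (q.num.natAbs.size + N + q.den.size + 1) := by
    rw [hnum]
    have ha := Nat.lt_size_self q.num.natAbs
    have hb := Nat.lt_size_self q.den
    have hb0 := q.den_pos
    have hc := Int.natAbs_add_le q.num (z * q.den)
    rw [Int.natAbs_mul, Int.natAbs_natCast] at hc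
    have hd : z.natAbs * q.den < 2 ^ (N + q.den.size) := by
      rw [pow_add]; exact Nat.mul_lt_mul'' hz hb
    have he : 2 ^ q.num.natAbs.size ≤ 2 ^ (q.num.natAbs.size + N + q.den.size) :=
      Nat.pow_le_pow_right (by norm_num) (by omega)
    have hf : 2 ^ (N + q.den.size) ≤ 2 ^ (q.num.natAbs.size + N + q.den.size) :=
      Nat.pow_le_pow_right (by norm_num) (by omega)
    rw [pow_succ]
    omega
  have h2 := Nat.size_le.2 h1
  simp only [ratSize, hden]
  omega

/-- The values that the program may compute: the bit size is polynomial if all `a i` are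
rational. -/
def SmallValue (d n m : ℕ) (f : Polynomial ℤ) (a : Fin n → ℝ) (v : ℝ) : Prop :=
  ∀ q : Fin n → ℚ, (∀ i, a i = (q i : ℝ)) → HasSizeLE (10 * inputSize d n m f q ^ 2) v

theorem smallValue_int {d n m : ℕ} (hd : 1 ≤ d) {f : Polynomial ℤ} {a : Fin n → ℝ} (z : ℤ)
    (hz : |z| ≤ intBound d n f) : SmallValue d n m f a z := by
  intro q _
  refine ⟨z, by simp, ?_⟩
  have h1 := intBound_lt d n m hd f q
  have h2 := ratSize_add_intCast_le (q := 0) (z := z) (N := 8 * inputSize d n m f q ^ 2)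
    (by rw [Int.abs_eq_natAbs] at hz; omega)
  rw [zero_add] at h2
  have h3 : ratSize 0 = 2 := by simp [ratSize]
  have h4 : 3 ≤ inputSize d n m f q := by
    simp only [inputSize, ratSize]; omega
  nlinarith

theorem smallValue_add {d n m : ℕ} (hd : 1 ≤ d) {f : Polynomial ℤ} {a : Fin n → ℝ} (j : Fin n)
    (z : ℤ) (hz : |z| ≤ intBound d n f) : SmallValue d n m f a (a j + z) := by
  intro q hq
  refine ⟨q j + z, by simp [hq], ?_⟩
  have h1 := intBound_lt d n m hd f q
  have h2 := ratSize_add_intCast_le (q := q j) (z := z) (N := 8 * inputSize d n m f q ^ 2)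
    (by rw [Int.abs_eq_natAbs] at hz; omega)
  have h3 : ratSize (q j) ≤ ∑ i, ratSize (q i) :=
    Finset.single_le_sum (f := fun i => ratSize (q i)) (fun _ _ => Nat.zero_le _) (Finset.mem_univ j)
  have h4 : 3 + ∑ i, ratSize (q i) ≤ inputSize d n m f q := by
    simp only [inputSize, ratSize]; omega
  -- The constant of `SmallValue`: `2 * L + 8 * L ^ 2 ≤ 10 * L ^ 2`.
  nlinarith

end Size

/-! ### The search of one row of a square. -/

/-- The register `49` receives the entry in the column `43` of the current row `46`. -/
def cellCmd : Cmd :=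
  .arith .mul 47 35 43 ;; .arith .add 47 34 47 ;; .arith .sub 48 47 46 ;; .load 49 0 47 ;;
    .load 50 3 48 ;; .arith .add 49 49 50

/-- The minimum of the current row over the columns from the register `43` to the register `42`
(exclusive); the value goes to the register `44`, the column to the register `45`. -/
def scanCmd : Cmd :=
  .whileLt 43 42
    (cellCmd ;; .ifLt 49 44 (.arith .add 44 49 3 ;; .arith .add 45 43 3) .skip ;;
      .arith .add 43 43 4)

/-- The row `38` of a square, whose minimum lies between those of the rows `38 - 37`, `38 + 37`. -/
def rowCmd : Cmd :=
  .arith .sub 40 38 37 ;; .load 41 6 40 ;; .arith .add 40 38 37 ;; .load 42 6 40 ;;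
  .arith .add 42 42 4 ;; .arith .add 46 33 38 ;; .arith .sub 46 46 4 ;; .arith .add 43 41 3 ;;
  .arith .add 45 41 3 ;; cellCmd ;; .arith .add 44 49 3 ;; scanCmd ;; .store 6 38 45 ;;
  .load 51 2 46 ;; .ifLt 44 51 (.store 2 46 44) .skip ;;
  .arith .add 38 38 37 ;; .arith .add 38 38 37

/-- The rows that are odd multiples of the stride `2 ^ t`, where `t + 1` is in the register `36`. -/
def strideCmd : Cmd :=
  .arith .sub 36 36 4 ;; .load 37 7 36 ;; .arith .add 38 37 3 ;; .whileLt 38 39 rowCmd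

/-- All row minima of a square. -/
def squareCmd : Cmd :=
  .arith .add 34 33 52 ;; .store 6 3 3 ;; .arith .add 40 20 20 ;; .arith .sub 53 20 4 ;;
  .store 6 40 53 ;; .arith .add 36 21 4 ;; .whileLt 3 36 strideCmd

/-- The entry in the row `r` and the column `c` of the square. -/
def entry (A F : ℕ → ℝ) (col : ℕ → ℕ) (k₀ r c : ℕ) : ℝ :=
  A (col c) + F (col c - (k₀ + r - 1))

/-- The state `s` describes the `w × w` square with the first row `k₀` and the columns `col c`. -/
structure SquareState (V : ℝ → Prop) (A F : ℕ → ℝ) (m w k₀ : ℕ) (col : ℕ → ℕ) (s : State) :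
    Prop where
  zero : s.reg 3 = 0
  one : s.reg 4 = 1
  width : s.reg 20 = w
  first : s.reg 33 = k₀
  width_succ : s.reg 39 = ((w + 1 : ℕ) : ℝ)
  arrA : s.arr 0 = A
  arrF : s.arr 3 = F
  col_eq : ∀ c < w, s.reg 34 + s.reg 35 * c = col c
  small_mul : ∀ c < w, V (s.reg 35 * c)
  small : ∀ x : ℕ, x ≤ 3 * w + k₀ → V x
  small_col : ∀ c < w, V (col c)
  small_sub : ∀ i < m, V ((i : ℕ) : ℝ)
  small_add : ∀ j, ∀ i < m, V (A j + F i)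
  le_col : ∀ r c, 1 ≤ r → r ≤ w → c < w → k₀ + r - 1 ≤ col c
  col_lt : ∀ r c, 1 ≤ r → r ≤ w → c < w → col c - (k₀ + r - 1) < m

theorem SquareState.congr {V : ℝ → Prop} {A F : ℕ → ℝ} {m w k₀ : ℕ} {col : ℕ → ℕ} {s s' : State}
    (h : SquareState V A F m w k₀ col s)
    (hr : ∀ x ∈ [3, 4, 20, 33, 34, 35, 39], s'.reg x = s.reg x)
    (ha : ∀ x ∈ [0, 3], s'.arr x = s.arr x) : SquareState V A F m w k₀ col s' where
  zero := by rw [hr 3 (by simp), h.zero]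
  one := by rw [hr 4 (by simp), h.one]
  width := by rw [hr 20 (by simp), h.width]
  first := by rw [hr 33 (by simp), h.first]
  width_succ := by rw [hr 39 (by simp), h.width_succ]
  arrA := by rw [ha 0 (by simp), h.arrA]
  arrF := by rw [ha 3 (by simp), h.arrF]
  col_eq := by rw [hr 34 (by simp), hr 35 (by simp)]; exact h.col_eq
  small_mul := by rw [hr 35 (by simp)]; exact h.small_mul
  small := h.small
  small_col := h.small_col
  small_sub := h.small_sub
  small_add := h.small_add
  le_col := h.le_col
  col_lt := h.col_lt

theorem SquareState.of_agree {V : ℝ → Prop} {A F : ℕ → ℝ} {m w k₀ : ℕ} {col : ℕ → ℕ} {s s' : State}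
    {P : Cmd} (h : SquareState V A F m w k₀ col s) (hA : Agree P s s')
    (hr : ∀ x ∈ [3, 4, 20, 33, 34, 35, 39], P.writesReg x = false)
    (ha : ∀ x ∈ [0, 3], P.writesArr x = false) : SquareState V A F m w k₀ col s' :=
  h.congr (fun x hx => hA.reg x (hr x hx)) fun x hx => hA.arr x (ha x hx)

section Square

variable {V : ℝ → Prop} {A F : ℕ → ℝ} {m w k₀ : ℕ} {col : ℕ → ℕ} {s : State}

/-- The column is an affine function of `c`, with offset in register `34` and direction in register
`35`. The fields `le_col` and `col_lt` make the difference of column and row a legal argument of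
`F`. -/
theorem wp_cell (hs : SquareState V A F m w k₀ col s) {r c : ℕ} (hr1 : 1 ≤ r) (hrw : r ≤ w)
    (hc : c < w) (h43 : s.reg 43 = c) (h46 : s.reg 46 = (k₀ + r - 1 : ℕ)) :
    wp V cellCmd s fun t s' => t = 6 ∧ s'.reg 49 = entry A F col k₀ r c := by
  have hle := hs.le_col r c hr1 hrw hc
  have hlt := hs.col_lt r c hr1 hrw hc
  refine wp_seq (wp_arith (s.reg 35 * c) (by simp [h43]) (hs.small_mul c hc) ?_)
  refine wp_seq (wp_arith (col c) (by simp [hs.col_eq c hc]) (hs.small_col c hc) ?_)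
  refine wp_seq (wp_arith ((col c - (k₀ + r - 1) : ℕ) : ℝ) (by simp [h46, Nat.cast_sub hle])
    (hs.small_sub _ hlt) ?_)
  refine wp_seq (wp_load (col c) (by simp) ?_)
  refine wp_seq (wp_load (col c - (k₀ + r - 1)) (by simp) ?_)
  refine wp_arith (entry A F col k₀ r c) (by simp [hs.arrA, hs.arrF, entry])
    (hs.small_add _ _ hlt) ?_
  simp

theorem wp_scan (hs : SquareState V A F m w k₀ col s) {r lo hi : ℕ} (hr1 : 1 ≤ r) (hrw : r ≤ w)
    (hlh : lo ≤ hi) (hhi : hi < w) (h43 : s.reg 43 = lo) (h42 : s.reg 42 = (hi + 1 : ℕ))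
    (h46 : s.reg 46 = (k₀ + r - 1 : ℕ)) (h45 : s.reg 45 = lo)
    (h44 : s.reg 44 = entry A F col k₀ r lo) :
    wp V scanCmd s fun t s' => t ≤ 11 * (hi + 1 - lo) + 1 ∧ ∃ p, lo ≤ p ∧ p ≤ hi ∧ s'.reg 45 = p ∧
      s'.reg 44 = entry A F col k₀ r p ∧
      ∀ c, lo ≤ c → c ≤ hi → entry A F col k₀ r p ≤ entry A F col k₀ r c := by
  -- The entry in column `lo` is preloaded as the first candidate; round `0` merely compares it with
  -- itself.
  refine wp_whileLt (hi + 1 - lo) (fun i s' => s'.reg 43 = (lo + i : ℕ) ∧ ∃ p, lo ≤ p ∧ p ≤ hi ∧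
    s'.reg 45 = p ∧ s'.reg 44 = entry A F col k₀ r p ∧
    ∀ c, lo ≤ c → c < lo + i → entry A F col k₀ r p ≤ entry A F col k₀ r c) (fun _ => 10)
    ⟨by simpa using h43, lo, le_rfl, hlh, h45, h44, fun c h1 h2 => by omega⟩ ?_ ?_ ?_
  · rintro i hi' s1 hA ⟨h1, p, hp1, hp2, hp3, hp4, hp5⟩
    have hs1 := hs.of_agree hA (by decide) (by decide)
    have e42 := (hA.reg 42 rfl).trans h42
    have e46 := (hA.reg 46 rfl).trans h46
    refine ⟨by rw [h1, e42]; exact_mod_cast (by omega), ?_⟩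
    refine wp_seq ((wp_cell hs1 hr1 hrw (c := lo + i) (by omega) h1 e46).mono ?_)
    rintro t s2 hA2 ⟨rfl, h49⟩
    have hs2 := hs1.of_agree hA2 (by decide) (by decide)
    have e43 := (hA2.reg 43 rfl).trans h1
    have e44 := (hA2.reg 44 rfl).trans hp4
    have e45 := (hA2.reg 45 rfl).trans hp3
    refine wp_seq (wp_ifLt (fun hlt => ?_) (fun hge => ?_))
    · rw [h49, e44] at hlt
      refine wp_seq (wp_arith (entry A F col k₀ r (lo + i)) (by simp [h49, hs2.zero])
        (hs.small_add _ _ (hs.col_lt _ _ hr1 hrw (by omega))) ?_)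
      refine wp_arith ((lo + i : ℕ) : ℝ) (by simp [e43, hs2.zero]) (hs.small _ (by omega)) ?_
      refine wp_arith ((lo + (i + 1) : ℕ) : ℝ) (by simp [e43, hs2.one]; ring)
        (hs.small _ (by omega)) ?_
      refine ⟨by norm_num, by simp, lo + i, by omega, by omega, by simp, by simp, fun c hc1 hc2 => ?_⟩
      rcases (show c < lo + i ∨ c = lo + i by omega) with h | rfl
      · exact hlt.le.trans (hp5 c hc1 h)
      · exact le_rfl
    · rw [h49, e44, not_lt] at hge
      refine wp_skip ?_
      refine wp_arith ((lo + (i + 1) : ℕ) : ℝ) (by simp [e43, hs2.one]; ring)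
        (hs.small _ (by omega)) ?_
      refine ⟨by norm_num, by simp, p, hp1, hp2, by simp [e45], by simp [e44], fun c hc1 hc2 => ?_⟩
      rcases (show c < lo + i ∨ c = lo + i by omega) with h | rfl
      · exact hp5 c hc1 h
      · exact hge
  · rintro s1 hA ⟨h1, -⟩
    rw [h1, (hA.reg 42 rfl).trans h42, not_lt]
    exact_mod_cast (by omega)
  · rintro t s1 hA ht ⟨-, p, hp1, hp2, hp3, hp4, hp5⟩
    refine ⟨by simp at ht; omega, p, hp1, hp2, hp3, hp4, fun c hc1 hc2 => hp5 c hc1 (by omega)⟩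

/-- The cost is proportional to the width of the bracket and not to `w`, so that it telescopes over
the rows of a stride. -/
theorem wp_row (hs : SquareState V A F m w k₀ col s) {r h : ℕ} {O : ℕ → ℕ} (hr1 : 1 ≤ r)
    (hrw : r ≤ w) (hh : h ≤ r) (hO : ∀ x, s.arr 6 x = O x) (hlh : O (r - h) ≤ O (r + h))
    (hhi : O (r + h) < w) (h38 : s.reg 38 = r) (h37 : s.reg 37 = h) :
    wp V rowCmd s fun t s' => t ≤ 11 * (O (r + h) - O (r - h)) + 37 ∧ s'.reg 38 = (r + 2 * h : ℕ) ∧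
      ∃ p, O (r - h) ≤ p ∧ p ≤ O (r + h) ∧ (∀ x, s'.arr 6 x = (Function.update O r p x : ℕ)) ∧
      (∀ c, O (r - h) ≤ c → c ≤ O (r + h) → entry A F col k₀ r p ≤ entry A F col k₀ r c) ∧
      s'.arr 2 = Function.update (s.arr 2) (k₀ + r - 1)
        (min (entry A F col k₀ r p) (s.arr 2 (k₀ + r - 1))) := by
  have z := hs.zero
  have o := hs.one
  refine wp_seq (wp_arith ((r - h : ℕ) : ℝ) (by simp [h38, h37, Nat.cast_sub hh])
    (hs.small _ (by omega)) ?_)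
  refine wp_seq (wp_load (r - h) (by simp) ?_)
  refine wp_seq (wp_arith ((r + h : ℕ) : ℝ) (by simp [h38, h37]) (hs.small _ (by omega)) ?_)
  refine wp_seq (wp_load (r + h) (by simp) ?_)
  refine wp_seq (wp_arith ((O (r + h) + 1 : ℕ) : ℝ) (by simp [hO, o]) (hs.small _ (by omega)) ?_)
  refine wp_seq (wp_arith ((k₀ + r : ℕ) : ℝ) (by simp [hs.first, h38]) (hs.small _ (by omega)) ?_)
  refine wp_seq (wp_arith ((k₀ + r - 1 : ℕ) : ℝ)
    (by simp [o, Nat.cast_sub (show 1 ≤ k₀ + r by omega)]) (hs.small _ (by omega)) ?_)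
  refine wp_seq (wp_arith ((O (r - h) : ℕ) : ℝ) (by simp [hO, z]) (hs.small _ (by omega)) ?_)
  refine wp_seq (wp_arith ((O (r - h) : ℕ) : ℝ) (by simp [hO, z]) (hs.small _ (by omega)) ?_)
  set s1 := State.setReg _ 45 _ with hs1d
  have a1 : s1.arr = s.arr := rfl
  have r1 : ∀ x, x ∉ [40, 41, 42, 43, 45, 46] → s1.reg x = s.reg x := by
    intro x hx
    simp only [List.mem_cons, List.not_mem_nil, or_false, not_or] at hx
    simp [hs1d, hx]
  have h1_42 : s1.reg 42 = (O (r + h) + 1 : ℕ) := by simp [hs1d]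
  have h1_43 : s1.reg 43 = O (r - h) := by simp [hs1d]
  have h1_45 : s1.reg 45 = O (r - h) := by simp [hs1d]
  have h1_46 : s1.reg 46 = (k₀ + r - 1 : ℕ) := by simp [hs1d]
  clear_value s1
  have hs1 : SquareState V A F m w k₀ col s1 :=
    hs.congr (fun x hx => r1 x (by revert x; decide)) fun x _ => by rw [a1]
  refine wp_seq ((wp_cell hs1 hr1 hrw (hlh.trans_lt hhi) h1_43 h1_46).mono ?_)
  rintro t s2 hA2 ⟨rfl, h49⟩
  have hs2 := hs1.of_agree hA2 (by decide) (by decide)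
  refine wp_seq (wp_arith (entry A F col k₀ r (O (r - h))) (by simp [h49, hs2.zero])
    (hs.small_add _ _ (hs.col_lt _ _ hr1 hrw (by omega))) ?_)
  set s3 := State.setReg s2 44 _ with hs3d
  have a3 : s3.arr = s2.arr := rfl
  have r3 : ∀ x, x ≠ 44 → s3.reg x = s2.reg x := by
    intro x hx
    simp [hs3d, hx]
  have h3_44 : s3.reg 44 = entry A F col k₀ r (O (r - h)) := by simp [hs3d]
  clear_value s3
  have hs3 : SquareState V A F m w k₀ col s3 :=
    hs2.congr (fun x hx => r3 x (by revert x; decide)) fun x _ => by rw [a3]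
  have h3_42 : s3.reg 42 = (O (r + h) + 1 : ℕ) := by
    rw [r3 _ (by decide), hA2.reg _ rfl, h1_42]
  have h3_43 : s3.reg 43 = O (r - h) := by rw [r3 _ (by decide), hA2.reg _ rfl, h1_43]
  have h3_45 : s3.reg 45 = O (r - h) := by rw [r3 _ (by decide), hA2.reg _ rfl, h1_45]
  have h3_46 : s3.reg 46 = (k₀ + r - 1 : ℕ) := by rw [r3 _ (by decide), hA2.reg _ rfl, h1_46]
  have h3_38 : s3.reg 38 = r := by
    rw [r3 _ (by decide), hA2.reg _ rfl, r1 _ (by decide), h38]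
  have h3_37 : s3.reg 37 = h := by
    rw [r3 _ (by decide), hA2.reg _ rfl, r1 _ (by decide), h37]
  have h3_a6 : s3.arr 6 = s.arr 6 := by rw [a3, hA2.arr _ rfl, a1]
  have h3_a2 : s3.arr 2 = s.arr 2 := by rw [a3, hA2.arr _ rfl, a1]
  refine wp_seq ((wp_scan hs3 hr1 hrw hlh hhi h3_43 h3_42 h3_46 h3_45 h3_44).mono ?_)
  rintro t s4 hA4 ⟨ht, p, hp1, hp2, hp3, hp4, hp5⟩
  have h4_46 := (hA4.reg 46 rfl).trans h3_46
  have h4_38 := (hA4.reg 38 rfl).trans h3_38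
  have h4_37 := (hA4.reg 37 rfl).trans h3_37
  have h4_a6 := (hA4.arr 6 rfl).trans h3_a6
  have h4_a2 := (hA4.arr 2 rfl).trans h3_a2
  refine wp_seq (wp_store r h4_38 ?_)
  refine wp_seq (wp_load (k₀ + r - 1) (by simp [h4_46]) ?_)
  have hupd : ∀ x, Function.update (s4.arr 6) r (s4.reg 45) x = (Function.update O r p x : ℕ) := by
    intro x
    by_cases hx : x = r
    · subst hx; simp [hp3]
    · simp [hx, h4_a6, hO]
  refine wp_seq (wp_ifLt (fun hlt => ?_) (fun hge => ?_))
  · simp [hp4, h4_a2] at hlt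
    refine wp_store (k₀ + r - 1) (by simp [h4_46]) ?_
    refine wp_seq (wp_arith ((r + h : ℕ) : ℝ) (by simp [h4_38, h4_37]) (hs.small _ (by omega)) ?_)
    refine wp_arith ((r + 2 * h : ℕ) : ℝ) (by simp [h4_37]; ring) (hs.small _ (by omega)) ?_
    refine ⟨by omega, by simp, p, hp1, hp2, by simpa using hupd, hp5, ?_⟩
    rw [min_eq_left hlt.le]
    simp [h4_a2, hp4]
  · simp [hp4, h4_a2] at hge
    refine wp_skip ?_
    refine wp_seq (wp_arith ((r + h : ℕ) : ℝ) (by simp [h4_38, h4_37]) (hs.small _ (by omega)) ?_)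
    refine wp_arith ((r + 2 * h : ℕ) : ℝ) (by simp [h4_37]; ring) (hs.small _ (by omega)) ?_
    refine ⟨by omega, by simp, p, hp1, hp2, by simpa using hupd, hp5, ?_⟩
    rw [min_eq_right hge]
    simp [h4_a2]

end Square

/-! ### All row minima of a square. -/

/-- Some entries of `C` have been replaced by smaller ones of the form `A (k + i) + F i`. -/
def Refines (A F : ℕ → ℝ) (m : ℕ) (C C' : ℕ → ℝ) : Prop :=
  ∀ k, C' k ≤ C k ∧ (C' k = C k ∨ ∃ i < m, C' k = A (k + i) + F i)

theorem Refines.refl (A F : ℕ → ℝ) (m : ℕ) (C : ℕ → ℝ) : Refines A F m C C :=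
  fun _ => ⟨le_rfl, Or.inl rfl⟩

theorem Refines.trans {A F : ℕ → ℝ} {m : ℕ} {C C' C'' : ℕ → ℝ} (h : Refines A F m C C')
    (h' : Refines A F m C' C'') : Refines A F m C C'' := fun k =>
  ⟨(h' k).1.trans (h k).1, (h' k).2.elim (fun e => by rw [e]; exact (h k).2) Or.inr⟩

theorem Refines.update_min {A F : ℕ → ℝ} {m : ℕ} {C : ℕ → ℝ} {k i : ℕ} (hi : i < m) {v : ℝ}
    (hv : v = A (k + i) + F i) : Refines A F m C (Function.update C k (min v (C k))) := by
  intro x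
  by_cases hx : x = k
  · subst hx
    rw [Function.update_self]
    refine ⟨min_le_right _ _, ?_⟩
    rcases min_choice v (C x) with h | h
    · exact Or.inr ⟨i, hi, h.trans hv⟩
    · exact Or.inl h
  · simp [hx]

theorem sum_range_succ_sub {g : ℕ → ℕ} {M : ℕ} (h : ∀ i < M, g i ≤ g (i + 1)) :
    ∑ i ∈ Finset.range M, (g (i + 1) - g i) + g 0 = g M := by
  induction M with
  | zero => simp
  | succ M ih =>
    rw [Finset.sum_range_succ]
    have := ih fun i hi => h i (by omega)
    have := h M (by omega)
    omega

section Square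

variable {V : ℝ → Prop} {A F : ℕ → ℝ} {m w k₀ : ℕ} {col : ℕ → ℕ} {s : State}

/-- Consecutive brackets share only an end column, so their widths add up to less than `w`, and `M`
rows cost O(w + M). -/
theorem wp_rows (hs : SquareState V A F m w k₀ col s) {h M : ℕ} {O : ℕ → ℕ} (hh : 0 < h)
    (hO : ∀ x, s.arr 6 x = O x) (hb : Bracket (entry A F col k₀) w (2 * h) M O)
    (hm : Monge (entry A F col k₀) w) (hle : ∀ i < M, (2 * i + 1) * h ≤ w) (hge : w ≤ M * (2 * h))
    (h38 : s.reg 38 = h) (h37 : s.reg 37 = h) :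
    wp V (.whileLt 38 39 rowCmd) s fun t s' => t ≤ 11 * w + 38 * M + 1 ∧
      (∃ O' : ℕ → ℕ, (∀ x, s'.arr 6 x = O' x) ∧ Bracket (entry A F col k₀) w h (2 * M) O') ∧
      Refines A F m (s.arr 2) (s'.arr 2) ∧
      ∀ i < M, ∀ c < w,
        s'.arr 2 (k₀ + (2 * i + 1) * h - 1) ≤ entry A F col k₀ ((2 * i + 1) * h) c := by
  have e1 : ∀ i, (2 * i + 1) * h - h = i * (2 * h) := fun i => by
    rw [show (2 * i + 1) * h = i * (2 * h) + h by ring]; omega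
  have e2 : ∀ i, (2 * i + 1) * h + h = (i + 1) * (2 * h) := fun i => by ring
  refine wp_whileLt M (fun i s' => s'.reg 38 = ((2 * i + 1) * h : ℕ) ∧
    (∃ O' : ℕ → ℕ, (∀ x, s'.arr 6 x = O' x) ∧ (∀ j, O' (j * (2 * h)) = O (j * (2 * h))) ∧
      ∀ j < i, O (j * (2 * h)) ≤ O' ((2 * j + 1) * h) ∧
        O' ((2 * j + 1) * h) ≤ O ((j + 1) * (2 * h)) ∧
        ∀ c < w, entry A F col k₀ ((2 * j + 1) * h) (O' ((2 * j + 1) * h)) ≤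
          entry A F col k₀ ((2 * j + 1) * h) c) ∧
      Refines A F m (s.arr 2) (s'.arr 2) ∧
      ∀ j < i, ∀ c < w,
        s'.arr 2 (k₀ + (2 * j + 1) * h - 1) ≤ entry A F col k₀ ((2 * j + 1) * h) c)
    (fun i => 11 * (O ((i + 1) * (2 * h)) - O (i * (2 * h))) + 37)
    ⟨by simp [h38], ⟨O, hO, fun _ => rfl, fun j hj => by omega⟩, Refines.refl _ _ _ _,
      fun j hj => by omega⟩ ?_ ?_ ?_
  · rintro i hi s1 hA ⟨h1, ⟨O', hO', heven, hodd⟩, href, hC⟩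
    have hs1 := hs.of_agree hA (by decide) (by decide)
    have hr1 : 1 ≤ (2 * i + 1) * h := Nat.mul_pos (by omega) hh
    have hhr : h ≤ (2 * i + 1) * h := Nat.le_mul_of_pos_left _ (by omega)
    refine ⟨by rw [h1, hs1.width_succ]; exact_mod_cast Nat.lt_succ_of_le (hle i hi), ?_⟩
    refine (wp_row hs1 hr1 (hle i hi) hhr hO' ?_ ?_ h1 ((hA.reg 37 rfl).trans h37)).mono ?_
    · rw [e1, e2, heven, heven]; exact hb.mono i hi
    · rw [e2, heven]; exact hb.lt _ hi
    rintro t s2 hA2 ⟨ht, h2, p, hp1, hp2, hp3, hp4, hp5⟩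
    rw [e1, e2, heven, heven] at ht hp4
    rw [e1, heven] at hp1
    rw [e2, heven] at hp2
    have hpw : p < w := hp2.trans_lt (hb.lt _ hi)
    have hmin := hb.isMin hi hr1 (hle i hi) (by rw [← e1]; omega) (by rw [← e2]; omega) hp4
    refine ⟨ht, by rw [h2]; congr 1; ring, ⟨_, hp3, fun j => ?_, fun j hj => ?_⟩, ?_, ?_⟩
    -- An even multiple of `h` is never the row being written.
    · rw [Function.update_of_ne, heven]
      intro h'
      have h'' : (2 * j) * h = (2 * i + 1) * h := by rw [← h']; ring
      have := Nat.eq_of_mul_eq_mul_right hh h''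
      omega
    · rcases (show j < i ∨ j = i by omega) with hji | rfl
      · rw [Function.update_of_ne]
        · exact hodd j hji
        · intro h'
          have := Nat.eq_of_mul_eq_mul_right hh h'
          omega
      · rw [Function.update_self]
        exact ⟨hp1, hp2, hmin⟩
    · refine href.trans ?_
      rw [hp5]
      refine Refines.update_min (hs.col_lt _ p hr1 (hle i hi) hpw) ?_
      rw [entry, Nat.add_sub_cancel' (hs.le_col _ p hr1 (hle i hi) hpw)]
    · intro j hj c hc
      rcases (show j < i ∨ j = i by omega) with hji | rfl
      · refine le_trans ?_ (hC j hji c hc)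
        rw [hp5, Function.update_apply]
        split_ifs with he
        · rw [he]; exact min_le_right _ _
        · exact le_rfl
      · rw [hp5, Function.update_self]
        exact (min_le_left _ _).trans (hmin c hc)
  · rintro s1 hA ⟨h1, -⟩
    rw [h1, (hs.of_agree hA (by decide) (by decide)).width_succ, not_lt]
    have : (2 * M + 1) * h = M * (2 * h) + h := by ring
    exact_mod_cast (by omega)
  · rintro t s1 hA ht ⟨-, ⟨O', hO', heven, hodd⟩, href, hC⟩
    refine ⟨ht.trans ?_, ⟨O', hO', hb.refine hm hh hle (fun i _ => heven i) hodd⟩, href, hC⟩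
    have hsum := sum_range_succ_sub (g := fun i => O (i * (2 * h))) hb.mono
    have hlt := hb.lt M le_rfl
    simp only [add_assoc, Finset.sum_add_distrib, ← Finset.mul_sum, Finset.sum_const,
      Finset.card_range, smul_eq_mul]
    omega

theorem wp_strides (hs : SquareState V A F m w k₀ col s) {S : ℕ} (hw : w = 2 ^ S) {O : ℕ → ℕ}
    (hO : ∀ x, s.arr 6 x = O x) (hO0 : O 0 = 0) (hO2 : O (2 * w) = w - 1)
    (hm : Monge (entry A F col k₀) w) (h36 : s.reg 36 = (S + 1 : ℕ))
    (h7 : ∀ x ≤ S, s.arr 7 x = (2 ^ x : ℕ)) :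
    wp V (.whileLt 3 36 strideCmd) s fun t s' => t ≤ 54 * w * (S + 1) + 1 ∧
      (∃ O : ℕ → ℕ, ∀ x, s'.arr 6 x = O x) ∧ Refines A F m (s.arr 2) (s'.arr 2) ∧
      ∀ r, 1 ≤ r → r ≤ w → ∀ c < w, s'.arr 2 (k₀ + r - 1) ≤ entry A F col k₀ r c := by
  have hw0 : 0 < w := by rw [hw]; positivity
  have hSw : S < w := by rw [hw]; exact Nat.lt_two_pow_self
  -- By truncated subtraction the number of brackets is `1` both at spacing `2 * w` and at spacing
  -- `w`; from then on it doubles. A round takes at most `11 * w + 38 * M + 4` steps with `M ≤ w`,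
  -- whence `54 * w - 1`.
  refine wp_whileLt (S + 1) (fun i s' => s'.reg 36 = (S + 1 - i : ℕ) ∧
    (∃ O' : ℕ → ℕ, (∀ x, s'.arr 6 x = O' x) ∧
      Bracket (entry A F col k₀) w (2 ^ (S + 1 - i)) (2 ^ (S - (S + 1 - i))) O') ∧
    Refines A F m (s.arr 2) (s'.arr 2) ∧
    ∀ r, 1 ≤ r → r ≤ w → 2 ^ (S + 1 - i) ∣ r → ∀ c < w,
      s'.arr 2 (k₀ + r - 1) ≤ entry A F col k₀ r c) (fun _ => 54 * w - 1)
    ⟨by simpa using h36, ⟨O, hO, ?_⟩, Refines.refl _ _ _ _, ?_⟩ ?_ ?_ ?_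
  · have := Bracket.init (val := entry A F col k₀) hw0 hO0 hO2
    rw [show S - (S + 1 - 0) = 0 by omega, show 2 ^ (S + 1 - 0) = 2 * w by rw [hw, Nat.sub_zero]; ring]
    exact this
  · intro r h1 h2 h3
    have := Nat.le_of_dvd h1 h3
    rw [show 2 ^ (S + 1 - 0) = 2 * w by rw [hw, Nat.sub_zero]; ring] at this
    omega
  · rintro i hi s1 hA ⟨h1, ⟨O', hO', hb⟩, href, hC⟩
    have hs1 := hs.of_agree hA (by decide) (by decide)
    refine ⟨by rw [h1, hs1.zero]; exact_mod_cast (by omega), ?_⟩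
    obtain ⟨t, ht⟩ : ∃ t, S + 1 - i = t + 1 := ⟨S - i, by omega⟩
    have ht' : S + 1 - (i + 1) = t := by omega
    rw [ht] at h1 hb hC
    rw [ht']
    have hpow : 2 ^ (t + 1) = 2 * 2 ^ t := by ring
    rw [hpow] at hb hC
    -- The first stride treats row `w` alone, between the fictitious rows `0` and `2 * w`. In all
    -- later strides the brackets tile the rows from `0` to `w` exactly.
    have hM : (t = S ∧ 2 ^ (S - (t + 1)) = 1 ∧ 2 ^ t = w ∧ 2 ^ (S - t) = 1) ∨
        (2 ^ (S - (t + 1)) * (2 * 2 ^ t) = w ∧ 2 ^ (S - t) = 2 * 2 ^ (S - (t + 1))) := by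
      rcases (show t = S ∨ t < S by omega) with rfl | hlt
      · left; simp [hw]
      · right
        constructor
        · rw [← hpow, ← pow_add, hw]; congr 1; omega
        · rw [← pow_succ']; congr 1; omega
    set M := 2 ^ (S - (t + 1)) with hMd
    have hh : 0 < 2 ^ t := by positivity
    set h := 2 ^ t with hhd
    have hle : ∀ i < M, (2 * i + 1) * h ≤ w := by
      intro i hi
      rcases hM with ⟨-, h1, h2, -⟩ | ⟨h1, -⟩
      · obtain rfl : i = 0 := by omega
        omega
      · calc (2 * i + 1) * h ≤ (2 * M) * h := Nat.mul_le_mul_right _ (by omega)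
          _ = w := by rw [← h1]; ring
    have hge : w ≤ M * (2 * h) := by
      rcases hM with ⟨-, h1, h2, -⟩ | ⟨h1, -⟩
      · rw [h1, h2]; omega
      · exact h1.ge
    have hMw : M ≤ w := by
      rw [hw, hMd]; exact Nat.pow_le_pow_right (by norm_num) (by omega)
    have hM' : 2 ^ (S - t) ≤ 2 * M := by
      rcases hM with ⟨-, h1, h2, h3⟩ | ⟨-, h1⟩ <;> omega
    have hhw : h ≤ w := by
      rw [hw, hhd]; exact Nat.pow_le_pow_right (by norm_num) (by omega)
    refine wp_seq (wp_arith (t : ℝ) (by simp [h1, hs1.one]) (hs.small _ (by omega)) ?_)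
    refine wp_seq (wp_load t (by simp) ?_)
    refine wp_seq (wp_arith (h : ℝ) ?_ (hs.small _ (by omega)) ?_)
    · simp [hA.arr 7 rfl, h7 t (by omega), hs1.zero, hhd]
    set s2 := State.setReg _ 38 _ with hs2d
    have r2 : ∀ x, x ∉ [36, 37, 38] → s2.reg x = s1.reg x := by
      intro x hx
      simp only [List.mem_cons, List.not_mem_nil, or_false, not_or] at hx
      simp [hs2d, hx]
    have a2 : s2.arr = s1.arr := rfl
    have h2_36 : s2.reg 36 = t := by simp [hs2d]
    have h2_37 : s2.reg 37 = h := by simp [hs2d, hA.arr 7 rfl, h7 t (by omega), hhd]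
    have h2_38 : s2.reg 38 = h := by simp [hs2d]
    clear_value s2
    have hs2 : SquareState V A F m w k₀ col s2 :=
      hs1.congr (fun x hx => r2 x (by revert x; decide)) fun x _ => by rw [a2]
    refine (wp_rows hs2 hh (by rw [a2]; exact hO') hb hm hle hge h2_38 h2_37).mono ?_
    rintro T s3 hA3 ⟨hT, ⟨O3, hO3, hb3⟩, href3, hC3⟩
    rw [a2] at href3
    -- After the first stride, `weaken` discards the bracket from `w` to `2 * w`.
    refine ⟨by omega, by rw [hA3.reg 36 rfl, h2_36], ⟨O3, hO3, hb3.weaken hM'⟩,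
      href.trans href3, ?_⟩
    rintro r hr1 hrw ⟨q, hq⟩ c hc
    obtain ⟨j, rfl | rfl⟩ := Nat.even_or_odd' q
    · exact ((href3 _).1).trans (hC r hr1 hrw ⟨j, by rw [hq]; ring⟩ c hc)
    · have hj : j < M := by
        by_contra hj
        have : M * (2 * h) ≤ j * (2 * h) := Nat.mul_le_mul_right _ (by omega)
        have : r = j * (2 * h) + h := by rw [hq]; ring
        omega
      have := hC3 j hj c hc
      rwa [mul_comm (2 * j + 1) h, ← hq] at this
  · rintro s1 hA ⟨h1, -⟩
    rw [h1, (hs.of_agree hA (by decide) (by decide)).zero]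
    simp
  · rintro t s1 hA ht ⟨-, ⟨O', hO', -⟩, href, hC⟩
    refine ⟨?_, ⟨O', hO'⟩, href, fun r h1 h2 => hC r h1 h2 (by simp)⟩
    have e : 54 * w - 1 + 1 = 54 * w := by omega
    simp only [e, Finset.sum_const, Finset.card_range, smul_eq_mul] at ht
    rwa [mul_comm (S + 1)] at ht

end Square

/-! ### The search over squares, diagonals and levels: programs. -/

/-- All squares along the diagonal `24`. -/
def squaresCmd : Cmd :=
  .const 33 0 ;; .whileLt 33 23 (squareCmd ;; .arith .add 33 33 20)

/-- Test whether the interval from the register `25` to the register `26` is good. The register `27`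
receives `0` if it is not, `1` if the sequence is convex and `2` if it is concave there. -/
def goodCmd : Cmd :=
  .const 27 0 ;; .ifLt 25 3 .skip
    (.ifLt 26 1
      (.arith .add 28 25 4 ;; .load 29 4 28 ;; .load 30 4 26 ;;
        .ifLt 29 30
          (.load 29 5 28 ;; .load 30 5 26 ;; .ifLt 29 30 .skip (.const 27 1))
          (.const 27 2))
      .skip)

/-- The squares along the diagonal `24`, if it is used. -/
def diagonalCmd : Cmd :=
  .arith .sub 25 24 54 ;; .arith .add 26 24 54 ;; goodCmd ;; .arith .add 32 27 3 ;;
  .arith .sub 25 24 55 ;; .arith .add 26 24 55 ;; goodCmd ;;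
  .ifLt 3 32
    (.ifLt 3 27 .skip
      (.ifLt 4 32 (.const 35 (-1) ;; .arith .add 52 24 54) (.const 35 1 ;; .arith .add 52 24 3) ;;
        squaresCmd))
    .skip ;;
  .arith .add 24 24 20

/-- All squares whose side is in the register `20`. -/
def levelCmd : Cmd :=
  .store 7 21 20 ;; .arith .add 39 20 4 ;; .arith .sub 54 20 4 ;; .arith .add 55 20 54 ;;
  .arith .add 55 55 20 ;; .const 24 0 ;; .whileLt 24 1 diagonalCmd ;;
  .arith .add 20 20 20 ;; .arith .add 21 21 4

/-- All levels. -/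
def levelsCmd : Cmd :=
  .const 20 1 ;; .const 21 0 ;; .whileLt 20 22 levelCmd

/-- The values that occur in the search are admissible. -/
structure Admissible (V : ℝ → Prop) (B n m : ℕ) (A F : ℕ → ℝ) : Prop where
  int : ∀ z : ℤ, |z| ≤ B → V z
  add : ∀ j, ∀ i < m, V (A j + F i)
  le : 8 * n + 8 ≤ B
  pos : 1 ≤ m
  m_le : m ≤ n

theorem Admissible.nat {V : ℝ → Prop} {B n m : ℕ} {A F : ℕ → ℝ} (h : Admissible V B n m A F)
    {x : ℕ} (hx : x ≤ 8 * n + 8) : V x := by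
  have := h.int x (by rw [Nat.abs_cast]; exact_mod_cast hx.trans h.le)
  simpa using this

/-! ### Testing convexity with prefix counts; invariants of the search. -/

open Classical in
/-- The number of convex positions. -/
noncomputable def convexCount (F : ℕ → ℝ) (k : ℕ) : ℕ :=
  Nat.count (fun t => F (t + 1) + F (t + 1) < F t + F (t + 2)) k

open Classical in
/-- The number of concave positions. -/
noncomputable def concaveCount (F : ℕ → ℝ) (k : ℕ) : ℕ :=
  Nat.count (fun t => F t + F (t + 2) < F (t + 1) + F (t + 1)) k

/-- Prefix counts are monotone, so one comparison of two of them decides whether `p` occurs in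
between. -/
theorem count_le_count_iff {p : ℕ → Prop} [DecidablePred p] {lo hi : ℕ} :
    Nat.count p hi ≤ Nat.count p lo ↔ ∀ t, lo ≤ t → t < hi → ¬ p t := by
  constructor
  · intro h t h1 h2 hp
    have a := Nat.count_monotone p h1
    have b := Nat.count_monotone p (show t + 1 ≤ hi from h2)
    rw [Nat.count_succ, if_pos hp] at b
    omega
  · intro h
    rcases le_total hi lo with hl | hl
    · exact Nat.count_monotone p hl
    · obtain ⟨k, rfl⟩ := Nat.exists_eq_add_of_le hl
      clear hl
      induction k with
      | zero => simp
      | succ k ih =>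
        rw [← add_assoc, Nat.count_succ, if_neg (h _ (by omega) (by omega)), add_zero]
        exact ih fun t h1 h2 => h t h1 (by omega)

/-- Concavity is the absence of strictly convex positions. The count stops at `hi - 1` because the
second difference at `t` reaches to `t + 2`. -/
theorem convexCount_le_iff {F : ℕ → ℝ} {lo hi : ℕ} :
    convexCount F (hi - 1) ≤ convexCount F lo ↔ DiscreteConcave F lo hi := by
  classical
  rw [convexCount, convexCount, count_le_count_iff]
  refine forall_congr' fun t => ?_
  rw [not_lt, Nat.cast_le, show (t < hi - 1 ↔ (t : ℤ) + 2 ≤ hi) by omega]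

theorem concaveCount_le_iff {F : ℕ → ℝ} {lo hi : ℕ} :
    concaveCount F (hi - 1) ≤ concaveCount F lo ↔ DiscreteConvex F lo hi := by
  classical
  rw [concaveCount, concaveCount, count_le_count_iff]
  refine forall_congr' fun t => ?_
  rw [not_lt, Nat.cast_le, show (t < hi - 1 ↔ (t : ℤ) + 2 ≤ hi) by omega]

/-- The registers and arrays that do not change during the search. -/
structure SearchState (A F : ℕ → ℝ) (n m : ℕ) (s : State) : Prop where
  zero : s.reg 3 = 0
  one : s.reg 4 = 1
  len : s.reg 1 = m
  rows : s.reg 23 = (n - m + 1 : ℕ)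
  arrA : s.arr 0 = A
  arrF : s.arr 3 = F
  convex : ∀ x ≤ m, s.arr 4 x = convexCount F (x - 1)
  concave : ∀ x ≤ m, s.arr 5 x = concaveCount F (x - 1)

theorem SearchState.congr {A F : ℕ → ℝ} {n m : ℕ} {s s' : State} (h : SearchState A F n m s)
    (hr : ∀ x ∈ [1, 3, 4, 23], s'.reg x = s.reg x) (ha : ∀ x ∈ [0, 3, 4, 5], s'.arr x = s.arr x) :
    SearchState A F n m s' where
  zero := by rw [hr 3 (by simp), h.zero]
  one := by rw [hr 4 (by simp), h.one]
  len := by rw [hr 1 (by simp), h.len]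
  rows := by rw [hr 23 (by simp), h.rows]
  arrA := by rw [ha 0 (by simp), h.arrA]
  arrF := by rw [ha 3 (by simp), h.arrF]
  convex := by rw [ha 4 (by simp)]; exact h.convex
  concave := by rw [ha 5 (by simp)]; exact h.concave

theorem SearchState.of_agree {A F : ℕ → ℝ} {n m : ℕ} {s s' : State} {P : Cmd}
    (h : SearchState A F n m s) (hA : Agree P s s')
    (hr : ∀ x ∈ [1, 3, 4, 23], P.writesReg x = false)
    (ha : ∀ x ∈ [0, 3, 4, 5], P.writesArr x = false) : SearchState A F n m s' :=
  h.congr (fun x hx => hA.reg x (hr x hx)) fun x hx => hA.arr x (ha x hx)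

/-- The registers and arrays that do not change while the squares of side `2 ^ S` are searched. -/
structure LevelState (A F : ℕ → ℝ) (n m S : ℕ) (s : State) : Prop extends
    SearchState A F n m s where
  width : s.reg 20 = (2 ^ S : ℕ)
  level : s.reg 21 = S
  width_succ : s.reg 39 = (2 ^ S + 1 : ℕ)
  pow : ∀ x ≤ S, s.arr 7 x = (2 ^ x : ℕ)

theorem LevelState.congr {A F : ℕ → ℝ} {n m S : ℕ} {s s' : State} (h : LevelState A F n m S s)
    (hr : ∀ x ∈ [1, 3, 4, 20, 21, 23, 39], s'.reg x = s.reg x)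
    (ha : ∀ x ∈ [0, 3, 4, 5, 7], s'.arr x = s.arr x) : LevelState A F n m S s' where
  toSearchState := h.toSearchState.congr (fun x hx => hr x (by revert x; decide))
    fun x hx => ha x (by revert x; decide)
  width := by rw [hr 20 (by simp), h.width]
  level := by rw [hr 21 (by simp), h.level]
  width_succ := by rw [hr 39 (by simp), h.width_succ]
  pow := by rw [ha 7 (by simp)]; exact h.pow

theorem LevelState.of_agree {A F : ℕ → ℝ} {n m S : ℕ} {s s' : State} {P : Cmd}
    (h : LevelState A F n m S s) (hA : Agree P s s')
    (hr : ∀ x ∈ [1, 3, 4, 20, 21, 23, 39], P.writesReg x = false)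
    (ha : ∀ x ∈ [0, 3, 4, 5, 7], P.writesArr x = false) : LevelState A F n m S s' :=
  h.congr (fun x hx => hA.reg x (hr x hx)) fun x hx => hA.arr x (ha x hx)

/-- The entries of `C` in the rows `k₀, …, k₀ + w - 1` are at most the entries of the matrix in the
columns `k₀ + e, …, k₀ + e + w - 1`. -/
def BelowSquare (A F C : ℕ → ℝ) (w e k₀ : ℕ) : Prop :=
  ∀ k j, k₀ ≤ k → k < k₀ + w → k₀ + e ≤ j → j < k₀ + e + w → C k ≤ A j + F (j - k)

theorem BelowSquare.of_refines {A F C C' : ℕ → ℝ} {m w e k₀ : ℕ} (h : BelowSquare A F C w e k₀)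
    (hr : Refines A F m C C') : BelowSquare A F C' w e k₀ := fun k j h1 h2 h3 h4 =>
  (hr k).1.trans (h k j h1 h2 h3 h4)

/-- The direction of the columns is set to match the shape of the sequence. -/
def Oriented (F : ℕ → ℝ) (w e : ℕ) (s : State) : Prop :=
  (s.reg 35 = 1 ∧ s.reg 52 = e ∧
    DiscreteConvex F ((e : ℤ) - w + 1) ((e : ℤ) + w - 1)) ∨
  (s.reg 35 = -1 ∧ s.reg 52 = (e + w - 1 : ℕ) ∧
    DiscreteConcave F ((e : ℤ) - w + 1) ((e : ℤ) + w - 1))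

/-! ### The search over squares, diagonals and levels: correctness and cost. -/

section Search

variable {V : ℝ → Prop} {B n m S : ℕ} {A F : ℕ → ℝ} {s : State}

/-- Array `6` still holds columns from earlier squares. These are harmless: the initial bracket
depends on the cells `0` and `2 * w` only, and both are reset. -/
theorem wp_square (hV : Admissible V B n m A F) (hs : LevelState A F n m S s) {w e k₀ : ℕ}
    (hw : w = 2 ^ S) (hlo : w ≤ e + 1) (hhi : e + w ≤ m) (hk : k₀ + m ≤ n)
    (hor : Oriented F w e s) (hO : ∃ O : ℕ → ℕ, ∀ x, s.arr 6 x = O x) (h33 : s.reg 33 = k₀) :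
    wp V squareCmd s fun t s' => t ≤ 54 * w * (S + 1) + 7 ∧
      (∃ O : ℕ → ℕ, ∀ x, s'.arr 6 x = O x) ∧
      Refines A F m (s.arr 2) (s'.arr 2) ∧ BelowSquare A F (s'.arr 2) w e k₀ := by
  classical
  have hw0 : 0 < w := by rw [hw]; positivity
  have hSw : S < w := by rw [hw]; exact Nat.lt_two_pow_self
  obtain ⟨O, hO⟩ := hO
  -- The direction in register `35` tells the convex case from the concave one.
  let P : Prop := s.reg 35 = 1
  have h34 : ∃ b : ℕ, s.reg 33 + s.reg 52 = b ∧ b ≤ 3 * n ∧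
      (∀ c < w, (b : ℝ) + s.reg 35 * c = column P (k₀ + e) w c) ∧
      (∀ c < w, V (s.reg 35 * c)) ∧
      if P then DiscreteConvex F ((e : ℤ) - w + 1) ((e : ℤ) + w - 1)
        else DiscreteConcave F ((e : ℤ) - w + 1) ((e : ℤ) + w - 1) := by
    rcases hor with ⟨h35, h52, hF⟩ | ⟨h35, h52, hF⟩
    · have hP : P := h35
      refine ⟨k₀ + e, by simp [h33, h52], by omega, fun c hc => ?_, fun c hc => ?_, ?_⟩
      · simp [column, hP, h35]
      · rw [h35, one_mul]; exact hV.nat (by omega)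
      · rwa [if_pos hP]
    · have hP : ¬ P := fun h => by
        have : (1 : ℝ) = -1 := h.symm.trans h35
        norm_num at this
      refine ⟨k₀ + (e + w - 1), by simp [h33, h52], by omega, fun c hc => ?_, fun c hc => ?_, ?_⟩
      · rw [column, if_neg hP, h35,
          show k₀ + (e + w - 1) = k₀ + e + (w - 1 - c) + c by omega]
        push_cast; ring
      · have := hV.int (-(c : ℤ)) (by
          rw [abs_neg, Nat.abs_cast]; have := hV.le; exact_mod_cast (by omega))
        rw [h35]; simpa using this
      · rwa [if_neg hP]
  obtain ⟨b, hb, hbn, hcol, hsgn, hF⟩ := h34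
  refine wp_seq (wp_arith (b : ℝ) (by simpa using hb) (hV.nat (by omega)) ?_)
  refine wp_seq (wp_store 0 (by simp [hs.zero]) ?_)
  refine wp_seq (wp_arith ((2 * w : ℕ) : ℝ) (by simp [hs.width, hw]; ring) (hV.nat (by omega)) ?_)
  refine wp_seq (wp_arith ((w - 1 : ℕ) : ℝ)
    (by simp [hs.width, hs.one, hw]) (hV.nat (by omega)) ?_)
  refine wp_seq (wp_store (2 * w) (by simp) ?_)
  refine wp_seq (wp_arith ((S + 1 : ℕ) : ℝ) (by simp [hs.level, hs.one]) (hV.nat (by omega)) ?_)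
  set s1 := State.setReg _ 36 _ with hs1d
  have r1 : ∀ x, x ∉ [34, 40, 53, 36] → s1.reg x = s.reg x := by
    intro x hx
    simp only [List.mem_cons, List.not_mem_nil, or_false, not_or] at hx
    simp [hs1d, hx]
  have a1 : ∀ x, x ≠ 6 → s1.arr x = s.arr x := by
    intro x hx
    simp [hs1d, hx]
  have h1_34 : s1.reg 34 = b := by simp [hs1d]
  have h1_36 : s1.reg 36 = (S + 1 : ℕ) := by simp [hs1d]
  have h1_O : ∀ x, s1.arr 6 x =
      (Function.update (Function.update O 0 0) (2 * w) (w - 1) x : ℕ) := by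
    intro x
    simp only [hs1d, State.setReg_arr, State.setArr_arr, if_true]
    by_cases hx : x = 2 * w
    · subst hx; simp
    · by_cases hx0 : x = 0
      · subst hx0; simp [hs.zero, Function.update_of_ne hx]
      · simp [hx, hx0, hO]
  clear_value s1
  have hcr : ∀ c < w, k₀ + e ≤ column P (k₀ + e) w c ∧ column P (k₀ + e) w c < k₀ + e + w := by
    intro c hc
    rw [column]; split_ifs <;> omega
  have hs1 : SquareState V A F m w k₀ (column P (k₀ + e) w) s1 :=
    { zero := by rw [r1 _ (by decide), hs.zero]
      one := by rw [r1 _ (by decide), hs.one]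
      width := by rw [r1 _ (by decide), hs.width, hw]
      first := by rw [r1 _ (by decide), h33]
      width_succ := by rw [r1 _ (by decide), hs.width_succ, hw]
      arrA := by rw [a1 _ (by decide), hs.arrA]
      arrF := by rw [a1 _ (by decide), hs.arrF]
      col_eq := by rw [h1_34, r1 35 (by decide)]; exact hcol
      small_mul := by rw [r1 35 (by decide)]; exact hsgn
      small := fun x hx => hV.nat (by omega)
      small_col := fun c hc => hV.nat (by have := hcr c hc; omega)
      small_sub := fun i hi => hV.nat (by omega)
      small_add := hV.add
      le_col := fun r c h1 h2 hc => by have := hcr c hc; omega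
      col_lt := fun r c h1 h2 hc => by have := hcr c hc; omega }
  have hm := monge_column (F := F) (A := A) (e := e) (w := w) (k := k₀) P rfl rfl (by omega) hF
  refine (wp_strides hs1 hw h1_O (by rw [Function.update_of_ne (by omega), Function.update_self])
    (by simp) hm h1_36 ?_).mono ?_
  · intro x hx; rw [a1 _ (by decide), hs.pow x hx]
  rintro t s2 hA ⟨ht, hO2, href, hC⟩
  rw [a1 2 (by decide)] at href
  refine ⟨by omega, hO2, href, fun k j hk1 hk2 hj1 hj2 => ?_⟩
  obtain ⟨c, hc, hcj⟩ : ∃ c < w, column P (k₀ + e) w c = j := by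
    by_cases hP : P
    · exact ⟨j - (k₀ + e), by omega, by rw [column, if_pos hP]; omega⟩
    · exact ⟨w - 1 - (j - (k₀ + e)), by omega, by rw [column, if_neg hP]; omega⟩
  have := hC (k - k₀ + 1) (by omega) (by omega) c hc
  rwa [entry, hcj, show k₀ + (k - k₀ + 1) - 1 = k by omega] at this

/-- The last square may run past row `n - m`, but `e + w ≤ m` keeps its columns below `n`. Since `w
≤ m`, the number of squares times `w` is at most `n`, which makes the diagonal cost O(n (S + 1)). -/
theorem wp_squares (hV : Admissible V B n m A F) (hs : LevelState A F n m S s) {w e : ℕ}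
    (hw : w = 2 ^ S) (hlo : w ≤ e + 1) (hhi : e + w ≤ m)
    (hor : Oriented F w e s) (hO : ∃ O : ℕ → ℕ, ∀ x, s.arr 6 x = O x) :
    wp V squaresCmd s fun t s' => t ≤ 64 * n * (S + 1) + 2 ∧
      (∃ O : ℕ → ℕ, ∀ x, s'.arr 6 x = O x) ∧
      Refines A F m (s.arr 2) (s'.arr 2) ∧
      ∀ i, i * w ≤ n - m → BelowSquare A F (s'.arr 2) w e (i * w) := by
  have hw0 : 0 < w := by rw [hw]; positivity
  have hmn := hV.m_le
  refine wp_seq (wp_const (by simpa using hV.nat (Nat.zero_le _)) ?_)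
  set s1 := State.setReg s 33 _ with hs1d
  have r1 : ∀ x, x ≠ 33 → s1.reg x = s.reg x := by
    intro x hx
    simp [hs1d, hx]
  have a1 : s1.arr = s.arr := rfl
  have h1_33 : s1.reg 33 = 0 := by simp [hs1d]
  clear_value s1
  have hs1 : LevelState A F n m S s1 :=
    hs.congr (fun x hx => r1 x (by revert x; decide)) fun x _ => by rw [a1]
  refine wp_whileLt ((n - m) / w + 1) (fun i s' => s'.reg 33 = (i * w : ℕ) ∧
    (∃ O : ℕ → ℕ, ∀ x, s'.arr 6 x = O x) ∧ Refines A F m (s.arr 2) (s'.arr 2) ∧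
    ∀ i' < i, BelowSquare A F (s'.arr 2) w e (i' * w)) (fun _ => 54 * w * (S + 1) + 8)
    ⟨by simp [h1_33], by rwa [a1], by rw [a1]; exact Refines.refl _ _ _ _, fun i hi => by omega⟩
    ?_ ?_ ?_
  · rintro i hi s2 hA ⟨h33, hO2, href, hB⟩
    have hs2 := hs1.of_agree hA (by decide) (by decide)
    have hiw : i * w ≤ n - m := (Nat.le_div_iff_mul_le hw0).1 (by omega)
    refine ⟨by rw [h33, hs2.rows]; exact_mod_cast Nat.lt_succ_of_le hiw, ?_⟩
    have hor2 : Oriented F w e s2 := by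
      rw [Oriented, hA.reg 35 rfl, hA.reg 52 rfl, r1 _ (by decide), r1 _ (by decide)]
      exact hor
    refine wp_seq ((wp_square hV hs2 hw hlo hhi (by omega) hor2 hO2 h33).mono ?_)
    rintro t s3 hA3 ⟨ht, hO3, href3, hB3⟩
    have hs3 := hs2.of_agree hA3 (by decide) (by decide)
    refine wp_arith (((i + 1) * w : ℕ) : ℝ) ?_ (hV.nat ?_) ?_
    · simp [hs3.width, hA3.reg 33 rfl, h33, hw]; ring
    · rw [add_mul]; omega
    refine ⟨by omega, by simp, by simpa using hO3, by simpa using href.trans href3, ?_⟩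
    intro i' hi'
    rcases (show i' < i ∨ i' = i by omega) with h | rfl
    · simpa using (hB i' h).of_refines href3
    · simpa using hB3
  · rintro s2 hA ⟨h33, -⟩
    rw [h33, (hs1.of_agree hA (by decide) (by decide)).rows, not_lt]
    have := Nat.lt_div_mul_add (a := n - m) hw0
    rw [add_mul]
    exact_mod_cast (by omega)
  · rintro t s2 hA ht ⟨-, hO2, href, hB⟩
    refine ⟨?_, hO2, href, fun i hi => hB i ?_⟩
    · rw [Finset.sum_const, Finset.card_range, smul_eq_mul] at ht
      have h1 : ((n - m) / w + 1) * w ≤ n := by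
        have := Nat.div_mul_le_self (n - m) w
        rw [add_mul]; omega
      have h2 : ((n - m) / w + 1) * (54 * w * (S + 1) + 8 + 1) ≤
          ((n - m) / w + 1) * (64 * w * (S + 1)) := by
        refine Nat.mul_le_mul_left _ ?_
        nlinarith [Nat.mul_le_mul hw0 (Nat.le_add_left 1 S)]
      have h3 : ((n - m) / w + 1) * (64 * w * (S + 1)) ≤ 64 * n * (S + 1) := by
        calc _ = 64 * (((n - m) / w + 1) * w) * (S + 1) := by ring
          _ ≤ _ := Nat.mul_le_mul_right _ (Nat.mul_le_mul_left _ h1)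
      omega
    · have := (Nat.le_div_iff_mul_le hw0).2 hi
      omega

/-- The ends are compared with `0` and `m` before any array access, since an access at a negative
index would be stuck. An interval on which `F` is affine is reported as concave. -/
theorem wp_good (hV : Admissible V B n m A F) (hs : SearchState A F n m s) {lo hi : ℤ}
    (hlh : lo ≤ hi) (h25 : s.reg 25 = lo) (h26 : s.reg 26 = hi) :
    wp V goodCmd s fun t s' => t ≤ 11 ∧ ((s'.reg 27 = 0 ∧ ¬ Good F m lo hi) ∨
      (s'.reg 27 = 1 ∧ 0 ≤ lo ∧ hi < m ∧ DiscreteConvex F lo hi) ∨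
      (s'.reg 27 = 2 ∧ 0 ≤ lo ∧ hi < m ∧ DiscreteConcave F lo hi)) := by
  refine wp_seq (wp_const (by simpa using hV.nat (Nat.zero_le _)) ?_)
  refine wp_ifLt (fun hlt => wp_skip ⟨by omega, Or.inl ⟨by simp, fun hg => ?_⟩⟩) (fun hge => ?_)
  · simp [h25, hs.zero] at hlt
    exact absurd hg.1 (by omega)
  simp [h25, hs.zero] at hge
  refine wp_ifLt (fun hlt => ?_) (fun hge' => wp_skip ⟨by omega, Or.inl ⟨by simp, fun hg => ?_⟩⟩)
  swap
  · simp [h26, hs.len] at hge'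
    exact absurd hg.2.1 (by have : (m : ℤ) ≤ hi := by exact_mod_cast hge'
                            omega)
  simp [h26, hs.len] at hlt
  replace hlt : hi < m := by exact_mod_cast hlt
  lift lo to ℕ using hge
  lift hi to ℕ using (by omega)
  have hmn := hV.m_le
  have hcx := hs.convex (lo + 1) (by omega)
  have hcx' := hs.convex hi (by omega)
  have hcc := hs.concave (lo + 1) (by omega)
  have hcc' := hs.concave hi (by omega)
  -- The counts are stored one cell further on: cell `lo + 1` holds the count below `lo`, and cell
  -- `hi` the count below `hi - 1`.
  refine wp_seq (wp_arith ((lo + 1 : ℕ) : ℝ) (by simp [h25, hs.one]) (hV.nat (by omega)) ?_)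
  refine wp_seq (wp_load (lo + 1) (by simp) ?_)
  refine wp_seq (wp_load hi (by simp [h26]) ?_)
  refine wp_ifLt (fun hx => ?_) (fun hx => ?_)
  · refine wp_seq (wp_load (lo + 1) (by simp) ?_)
    refine wp_seq (wp_load hi (by simp [h26]) ?_)
    simp [hcx, hcx'] at hx
    refine wp_ifLt (fun hv => ?_) (fun hv => ?_)
    · simp [hcc, hcc'] at hv
      refine wp_skip ⟨by omega, Or.inl ⟨by simp, fun hg => ?_⟩⟩
      rcases hg.2.2 with h | h
      · have := convexCount_le_iff.2 h; omega
      · have := concaveCount_le_iff.2 h; omega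
    · simp [hcc, hcc'] at hv
      refine wp_const (by simpa using hV.nat (show 1 ≤ 8 * n + 8 by omega)) ?_
      exact ⟨by omega, Or.inr (Or.inl ⟨by simp, by omega, hlt, concaveCount_le_iff.1 hv⟩)⟩
  · simp [hcx, hcx'] at hx
    refine wp_const (by simpa using hV.nat (show 2 ≤ 8 * n + 8 by omega)) ?_
    exact ⟨by omega, Or.inr (Or.inr ⟨by simp, by omega, hlt, convexCount_le_iff.1 hx⟩)⟩

-- An unused diagonal is charged only a constant, for the two tests. This matters because a level
-- can have up to `m` diagonals, few of which are used.
open Classical in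
theorem wp_diagonal (hV : Admissible V B n m A F) (hs : LevelState A F n m S s) {w e : ℕ}
    (hw : w = 2 ^ S) (he : e < m) (hwm : w ≤ m)
    (hO : ∃ O : ℕ → ℕ, ∀ x, s.arr 6 x = O x) (h24 : s.reg 24 = e)
    (h54 : s.reg 54 = (w - 1 : ℕ)) (h55 : s.reg 55 = (3 * w - 1 : ℕ)) :
    wp V diagonalCmd s fun t s' =>
      t ≤ 34 + (if Used F m w e then 64 * n * (S + 1) + 6 else 0) ∧ s'.reg 24 = (e + w : ℕ) ∧
      (∃ O : ℕ → ℕ, ∀ x, s'.arr 6 x = O x) ∧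
      Refines A F m (s.arr 2) (s'.arr 2) ∧
      (Used F m w e → ∀ i, i * w ≤ n - m → BelowSquare A F (s'.arr 2) w e (i * w)) := by
  have hw0 : 0 < w := by rw [hw]; positivity
  have hmn := hV.m_le
  have hB := hV.le
  have hZ : ∀ z : ℤ, -(8 * n + 8) ≤ z → z ≤ 8 * n + 8 → V z := fun z h1 h2 =>
    hV.int z (abs_le.2 ⟨by have : (8 * n + 8 : ℤ) ≤ B := by exact_mod_cast hB
                           omega, by have : (8 * n + 8 : ℤ) ≤ B := by exact_mod_cast hB
                                     omega⟩)
  refine wp_seq (wp_arith (((e : ℤ) - w + 1 : ℤ) : ℝ)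
    (by simp [h24, h54, Nat.cast_sub hw0]; ring) (hZ _ (by omega) (by omega)) ?_)
  refine wp_seq (wp_arith (((e : ℤ) + w - 1 : ℤ) : ℝ)
    (by simp [h24, h54, Nat.cast_sub hw0]; ring) (hZ _ (by omega) (by omega)) ?_)
  set s1 := State.setReg _ 26 _ with hs1d
  have r1 : ∀ x, x ∉ [25, 26] → s1.reg x = s.reg x := by
    intro x hx
    simp only [List.mem_cons, List.not_mem_nil, or_false, not_or] at hx
    simp [hs1d, hx]
  have a1 : s1.arr = s.arr := rfl
  have h1_25 : s1.reg 25 = (((e : ℤ) - w + 1 : ℤ) : ℝ) := by simp [hs1d]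
  have h1_26 : s1.reg 26 = (((e : ℤ) + w - 1 : ℤ) : ℝ) := by simp [hs1d]
  clear_value s1
  have hs1 : LevelState A F n m S s1 :=
    hs.congr (fun x hx => r1 x (by revert x; decide)) fun x _ => by rw [a1]
  refine wp_seq ((wp_good hV hs1.toSearchState (by omega) h1_25 h1_26).mono ?_)
  rintro t2 s2 hA2 ⟨ht2, hg⟩
  have hs2 := hs1.of_agree hA2 (by decide) (by decide)
  have h2_24 : s2.reg 24 = e := by rw [hA2.reg _ rfl, r1 _ (by decide), h24]
  have h2_54 : s2.reg 54 = (w - 1 : ℕ) := by rw [hA2.reg _ rfl, r1 _ (by decide), h54]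
  have h2_55 : s2.reg 55 = (3 * w - 1 : ℕ) := by rw [hA2.reg _ rfl, r1 _ (by decide), h55]
  have hV27 : V (s2.reg 27) := by
    rcases hg with ⟨h, -⟩ | ⟨h, -⟩ | ⟨h, -⟩ <;> rw [h]
    · simpa using hV.nat (show 0 ≤ 8 * n + 8 by omega)
    · simpa using hV.nat (show 1 ≤ 8 * n + 8 by omega)
    · simpa using hV.nat (show 2 ≤ 8 * n + 8 by omega)
  refine wp_seq (wp_arith (s2.reg 27) (by simp [hs2.zero]) hV27 ?_)
  refine wp_seq (wp_arith (((e : ℤ) - 3 * w + 1 : ℤ) : ℝ)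
    (by simp [h2_24, h2_55, Nat.cast_sub (show 1 ≤ 3 * w by omega)]; ring)
    (hZ _ (by omega) (by omega)) ?_)
  refine wp_seq (wp_arith (((e : ℤ) + 3 * w - 1 : ℤ) : ℝ)
    (by simp [h2_24, h2_55, Nat.cast_sub (show 1 ≤ 3 * w by omega)]; ring)
    (hZ _ (by omega) (by omega)) ?_)
  set s3 := State.setReg _ 26 _ with hs3d
  have r3 : ∀ x, x ∉ [25, 26, 32] → s3.reg x = s2.reg x := by
    intro x hx
    simp only [List.mem_cons, List.not_mem_nil, or_false, not_or] at hx
    simp [hs3d, hx]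
  have a3 : s3.arr = s2.arr := rfl
  have h3_25 : s3.reg 25 = (((e : ℤ) - 3 * w + 1 : ℤ) : ℝ) := by simp [hs3d]
  have h3_26 : s3.reg 26 = (((e : ℤ) + 3 * w - 1 : ℤ) : ℝ) := by simp [hs3d]
  have h3_32 : s3.reg 32 = s2.reg 27 := by simp [hs3d]
  clear_value s3
  have hs3 : LevelState A F n m S s3 :=
    hs2.congr (fun x hx => r3 x (by revert x; decide)) fun x _ => by rw [a3]
  refine wp_seq ((wp_good hV hs3.toSearchState (by omega) h3_25 h3_26).mono ?_)
  rintro t4 s4 hA4 ⟨ht4, hg4⟩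
  have hs4 := hs3.of_agree hA4 (by decide) (by decide)
  have h4_32 : s4.reg 32 = s2.reg 27 := (hA4.reg _ rfl).trans h3_32
  have h4_24 : s4.reg 24 = e := by rw [hA4.reg _ rfl, r3 _ (by decide), h2_24]
  have h4_54 : s4.reg 54 = (w - 1 : ℕ) := by rw [hA4.reg _ rfl, r3 _ (by decide), h2_54]
  have h4_a : ∀ x, s4.arr x = s.arr x := fun x => by
    rw [hA4.arr _ rfl, a3, hA2.arr _ rfl, a1]
  have hO4 : ∃ O : ℕ → ℕ, ∀ x, s4.arr 6 x = O x := by rwa [h4_a]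
  rw [← h4_a 2]
  -- The common exit of the branches that skip the diagonal; `T` is the time already spent.
  have hnot : ∀ T, ¬ Used F m w e → T ≤ 33 →
      wp V (.arith .add 24 24 20) s4 fun t s' =>
        T + t ≤ 34 + (if Used F m w e then 64 * n * (S + 1) + 6 else 0) ∧
        s'.reg 24 = (e + w : ℕ) ∧ (∃ O : ℕ → ℕ, ∀ x, s'.arr 6 x = O x) ∧
        Refines A F m (s4.arr 2) (s'.arr 2) ∧
        (Used F m w e → ∀ i, i * w ≤ n - m → BelowSquare A F (s'.arr 2) w e (i * w)) := by
    intro T hu hT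
    refine wp_arith ((e + w : ℕ) : ℝ) (by simp [h4_24, hs4.width, hw]) (hV.nat (by omega)) ?_
    exact ⟨by omega, by simp, by simpa using hO4, by simpa using Refines.refl _ _ _ _,
      fun h => absurd h hu⟩
  refine wp_seq (wp_ifLt (fun h32 => ?_) (fun h32 => wp_skip ?_))
  swap
  · rw [h4_32, hs4.zero] at h32
    have hu : ¬ Used F m w e := fun hu => by
      rcases hg with ⟨h, hn⟩ | ⟨h, -⟩ | ⟨h, -⟩
      · exact hn hu.1
      · rw [h] at h32; norm_num at h32
      · rw [h] at h32; norm_num at h32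
    exact (hnot 33 hu le_rfl).mono fun t s' _ h => ⟨by have := h.1; omega, h.2⟩
  refine wp_ifLt (fun h27 => wp_skip ?_) (fun h27 => ?_)
  · rw [hs4.zero] at h27
    have hu : ¬ Used F m w e := fun hu => by
      rcases hg4 with ⟨h, hn⟩ | ⟨-, h⟩ | ⟨-, h⟩
      · rw [h] at h27; norm_num at h27
      · exact hu.2 ⟨h.1, h.2.1, Or.inr h.2.2⟩
      · exact hu.2 ⟨h.1, h.2.1, Or.inl h.2.2⟩
    exact (hnot 33 hu le_rfl).mono fun t s' _ h => ⟨by have := h.1; omega, h.2⟩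
  rw [hs4.zero] at h27
  rw [h4_32, hs4.zero] at h32
  have hg4' : ¬ Good F m ((e : ℤ) - 3 * w + 1) ((e : ℤ) + 3 * w - 1) := by
    rcases hg4 with ⟨-, h⟩ | ⟨h, -⟩ | ⟨h, -⟩
    · exact h
    · rw [h] at h27; norm_num at h27
    · rw [h] at h27; norm_num at h27
  have hlh : 0 ≤ (e : ℤ) - w + 1 ∧ (e : ℤ) + w - 1 < m ∧ Used F m w e := by
    rcases hg with ⟨h, -⟩ | ⟨-, h⟩ | ⟨-, h⟩
    · rw [h] at h32; norm_num at h32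
    · exact ⟨h.1, h.2.1, ⟨h.1, h.2.1, Or.inr h.2.2⟩, hg4'⟩
    · exact ⟨h.1, h.2.1, ⟨h.1, h.2.1, Or.inl h.2.2⟩, hg4'⟩
  obtain ⟨hlo, hhi, hu⟩ := hlh
  have hfin : ∀ s5 : State, (∀ x, x ∉ [35, 52] → s5.reg x = s4.reg x) → s5.arr = s4.arr →
      Oriented F w e s5 → wp V squaresCmd s5 fun t s' => t ≤ 64 * n * (S + 1) + 2 ∧
        (∃ O : ℕ → ℕ, ∀ x, s'.arr 6 x = O x) ∧
        Refines A F m (s4.arr 2) (s'.arr 2) ∧ LevelState A F n m S s' ∧ s'.reg 24 = e ∧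
        ∀ i, i * w ≤ n - m → BelowSquare A F (s'.arr 2) w e (i * w) := by
    intro s5 r5 a5 hor
    have hs5 : LevelState A F n m S s5 :=
      hs4.congr (fun x hx => r5 x (by revert x; decide)) fun x _ => by rw [a5]
    refine (wp_squares hV hs5 hw (by omega) (by omega) hor (by rwa [a5])).mono ?_
    rintro t s6 hA6 ⟨h1, h2, h3, h4⟩
    exact ⟨h1, h2, by rwa [a5] at h3, hs5.of_agree hA6 (by decide) (by decide),
      by rw [hA6.reg _ rfl, r5 _ (by decide), h4_24], h4⟩
  have hend : ∀ (T t : ℕ) (s6 : State), T + t ≤ 33 + 64 * n * (S + 1) + 6 →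
      (∃ O : ℕ → ℕ, ∀ x, s6.arr 6 x = O x) ∧
        Refines A F m (s4.arr 2) (s6.arr 2) ∧ LevelState A F n m S s6 ∧ s6.reg 24 = e ∧
        (∀ i, i * w ≤ n - m → BelowSquare A F (s6.arr 2) w e (i * w)) →
      wp V (.arith .add 24 24 20) s6 fun t' s' =>
        T + (t + t') ≤ 34 + (if Used F m w e then 64 * n * (S + 1) + 6 else 0) ∧
        s'.reg 24 = (e + w : ℕ) ∧ (∃ O : ℕ → ℕ, ∀ x, s'.arr 6 x = O x) ∧
        Refines A F m (s4.arr 2) (s'.arr 2) ∧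
        (Used F m w e → ∀ i, i * w ≤ n - m → BelowSquare A F (s'.arr 2) w e (i * w)) := by
    rintro T t s6 hT ⟨h1, h2, h3, h4, h5⟩
    refine wp_arith ((e + w : ℕ) : ℝ) (by simp [h4, h3.width, hw]) (hV.nat (by omega)) ?_
    rw [if_pos hu]
    exact ⟨by omega, by simp, by simpa using h1, by simpa using h2, fun _ => by simpa using h5⟩
  refine wp_seq (wp_ifLt (fun hcc => ?_) (fun hcc => ?_))
  · rw [hs4.one, h4_32] at hcc
    refine wp_seq (wp_const (by simpa using hZ (-1) (by omega) (by omega)) ?_)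
    refine wp_arith ((e + w - 1 : ℕ) : ℝ)
      (by simp [h4_24, h4_54, Nat.cast_sub (show 1 ≤ e + w by omega), Nat.cast_sub hw0]; ring)
      (hV.nat (by omega)) ?_
    refine (hfin _ ?_ ?_ ?_).mono ?_
    · intro x hx
      simp only [List.mem_cons, List.not_mem_nil, or_false, not_or] at hx
      simp [hx]
    · rfl
    · refine Or.inr ⟨by simp, by simp, ?_⟩
      rcases hg with ⟨h, -⟩ | ⟨h, -⟩ | ⟨-, h⟩
      · rw [h] at hcc; norm_num at hcc
      · rw [h] at hcc; norm_num at hcc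
      · exact h.2.2
    · rintro t s6 - ⟨ht, h⟩
      refine (hend 31 (t + 6) s6 (by omega) h).mono fun t' s' _ h' => ⟨?_, h'.2⟩
      have := h'.1
      omega
  · rw [hs4.one, h4_32] at hcc
    refine wp_seq (wp_const (by simpa using hZ 1 (by omega) (by omega)) ?_)
    refine wp_arith (e : ℝ) (by simp [h4_24, hs4.zero]) (hV.nat (by omega)) ?_
    refine (hfin _ ?_ ?_ ?_).mono ?_
    · intro x hx
      simp only [List.mem_cons, List.not_mem_nil, or_false, not_or] at hx
      simp [hx]
    · rfl
    · refine Or.inl ⟨by simp, by simp, ?_⟩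
      rcases hg with ⟨h, -⟩ | ⟨-, h⟩ | ⟨h, -⟩
      · rw [h] at h32; norm_num at h32
      · exact h.2.2
      · rw [h] at hcc; norm_num at hcc
    · rintro t s6 - ⟨ht, h⟩
      refine (hend 31 (t + 6) s6 (by omega) h).mono fun t' s' _ h' => ⟨?_, h'.2⟩
      have := h'.1
      omega

end Search

/-- The squares of side `w` on the used diagonals are below `C`. -/
def BelowLevel (A F C : ℕ → ℝ) (n m w : ℕ) : Prop :=
  ∀ D, D * w < m → Used F m w (D * w) → ∀ i, i * w ≤ n - m → BelowSquare A F C w (D * w) (i * w)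

theorem BelowLevel.of_refines {A F C C' : ℕ → ℝ} {n m w : ℕ} (h : BelowLevel A F C n m w)
    (hr : Refines A F m C C') : BelowLevel A F C' n m w := fun D h1 h2 i h3 =>
  (h D h1 h2 i h3).of_refines hr

/-- The cell in row `k` and column `k + i` lies in the aligned square supplied by `exists_used`: its
row block is `k / 2 ^ S`, and the diagonal is the distance of the column block from the row block.
-/
theorem le_of_belowLevel {A F C : ℕ → ℝ} {n m : ℕ}
    (h : ∀ S, 2 ^ S ≤ m → BelowLevel A F C n m (2 ^ S)) {k i : ℕ} (hk : k + m ≤ n) (hi : i < m) :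
    C k ≤ A (k + i) + F i := by
  obtain ⟨S, hS, hu⟩ := exists_used F hi k
  have hw : 0 < 2 ^ S := by positivity
  have hD : ((k + i) / 2 ^ S - k / 2 ^ S) * 2 ^ S < m := by
    have := hu.1.2.1
    omega
  have h1 := Nat.div_mul_le_self k (2 ^ S)
  have h2 := Nat.lt_div_mul_add (a := k) hw
  have h3 := Nat.div_mul_le_self (k + i) (2 ^ S)
  have h4 := Nat.lt_div_mul_add (a := k + i) hw
  have h5 : k / 2 ^ S * 2 ^ S ≤ (k + i) / 2 ^ S * 2 ^ S :=
    Nat.mul_le_mul_right _ (Nat.div_le_div_right (Nat.le_add_right _ _))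
  have := h S hS _ hD hu (k / 2 ^ S) (by omega) k (k + i) h1 h2
    (by rw [Nat.sub_mul]; omega) (by rw [Nat.sub_mul]; omega)
  rwa [Nat.add_sub_cancel_left] at this

section Search

variable {V : ℝ → Prop} {B n m S : ℕ} {A F : ℕ → ℝ} {s : State}

/-- At most `n` diagonals are charged a constant, and by `card_used_le` at most `12 * d` of them are
charged O(n (S + 1)) in addition. -/
theorem wp_level (hV : Admissible V B n m A F) (hs : SearchState A F n m s) {d : ℕ} (hd : 1 ≤ d)
    {f : Polynomial ℤ} (hf : f.natDegree ≤ d) (hF : ∀ i < m, F i = (f.eval (i : ℤ) : ℤ))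
    (h20 : s.reg 20 = (2 ^ S : ℕ)) (h21 : s.reg 21 = S) (hm : 2 ^ S ≤ m)
    (h7 : ∀ x < S, s.arr 7 x = (2 ^ x : ℕ)) (hO : ∃ O : ℕ → ℕ, ∀ x, s.arr 6 x = O x) :
    wp V levelCmd s fun t s' => t ≤ 900 * d * n * (S + 1) ∧
      s'.reg 20 = (2 ^ (S + 1) : ℕ) ∧ s'.reg 21 = (S + 1 : ℕ) ∧
      (∀ x < S + 1, s'.arr 7 x = (2 ^ x : ℕ)) ∧ (∃ O : ℕ → ℕ, ∀ x, s'.arr 6 x = O x) ∧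
      Refines A F m (s.arr 2) (s'.arr 2) ∧ BelowLevel A F (s'.arr 2) n m (2 ^ S) := by
  classical
  obtain ⟨w, hw⟩ : ∃ w, w = 2 ^ S := ⟨_, rfl⟩
  rw [← hw] at hm h20 ⊢
  have hw0 : 0 < w := by rw [hw]; positivity
  have hSw : S < w := by rw [hw]; exact Nat.lt_two_pow_self
  have hmn := hV.m_le
  refine wp_seq (wp_store S h21 ?_)
  refine wp_seq (wp_arith ((w + 1 : ℕ) : ℝ) (by simp [h20, hs.one]) (hV.nat (by omega)) ?_)
  refine wp_seq (wp_arith ((w - 1 : ℕ) : ℝ) (by simp [h20, hs.one, Nat.cast_sub hw0])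
    (hV.nat (by omega)) ?_)
  refine wp_seq (wp_arith ((w + (w - 1) : ℕ) : ℝ) (by simp [h20]) (hV.nat (by omega)) ?_)
  refine wp_seq (wp_arith ((3 * w - 1 : ℕ) : ℝ)
    (by rw [show 3 * w - 1 = w + (w - 1) + w by omega]; simp [h20]) (hV.nat (by omega)) ?_)
  refine wp_seq (wp_const (by simpa using hV.nat (Nat.zero_le _)) ?_)
  set s1 := State.setReg _ 24 _ with hs1d
  have r1 : ∀ x, x ∉ [39, 54, 55, 24] → s1.reg x = s.reg x := by
    intro x hx
    simp only [List.mem_cons, List.not_mem_nil, or_false, not_or] at hx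
    simp [hs1d, hx]
  have a1 : ∀ x, x ≠ 7 → s1.arr x = s.arr x := by
    intro x hx
    simp [hs1d, hx]
  have h1_7 : ∀ x < S + 1, s1.arr 7 x = (2 ^ x : ℕ) := by
    intro x hx
    rcases (show x = S ∨ x < S by omega) with rfl | h
    · simp [hs1d, h20, hw]
    · simp [hs1d, h.ne, h7 x h]
  have h1_24 : s1.reg 24 = 0 := by simp [hs1d]
  have h1_39 : s1.reg 39 = (w + 1 : ℕ) := by simp [hs1d]
  have h1_54 : s1.reg 54 = (w - 1 : ℕ) := by simp [hs1d]
  have h1_55 : s1.reg 55 = (3 * w - 1 : ℕ) := by simp [hs1d]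
  clear_value s1
  have hs1 : LevelState A F n m S s1 :=
    { hs.congr (fun x hx => r1 x (by revert x; decide))
        (fun x hx => a1 x (by revert x; decide)) with
      width := by rw [r1 _ (by decide), h20, hw]
      level := by rw [r1 _ (by decide), h21]
      width_succ := by rw [h1_39, hw]
      pow := fun x hx => h1_7 x (by omega) }
  refine wp_seq (wp_whileLt ((m - 1) / w + 1) (fun i s' => s'.reg 24 = (i * w : ℕ) ∧
    (∃ O : ℕ → ℕ, ∀ x, s'.arr 6 x = O x) ∧ Refines A F m (s1.arr 2) (s'.arr 2) ∧
    ∀ D < i, Used F m w (D * w) → ∀ i, i * w ≤ n - m → BelowSquare A F (s'.arr 2) w (D * w) (i * w))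
    (fun i => 34 + (if Used F m w (i * w) then 64 * n * (S + 1) + 6 else 0))
    ⟨by simp [h1_24], by rwa [a1 6 (by decide)], Refines.refl _ _ _ _, fun i hi => by omega⟩
    ?_ ?_ ?_)
  · rintro i hi s2 hA ⟨h24, hO2, href, hB⟩
    have hs2 := hs1.of_agree hA (by decide) (by decide)
    have hiw : i * w ≤ m - 1 := (Nat.le_div_iff_mul_le hw0).1 (by omega)
    have := hV.pos
    refine ⟨by rw [h24, hs2.len]; exact_mod_cast (by omega), ?_⟩
    refine (wp_diagonal hV hs2 hw (by omega) hm hO2 h24 ((hA.reg _ rfl).trans h1_54)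
      ((hA.reg _ rfl).trans h1_55)).mono ?_
    rintro t s3 hA3 ⟨ht, h3, hO3, href3, hB3⟩
    refine ⟨by convert ht, by rw [h3, add_mul, one_mul], hO3, href.trans href3, fun D hD hu j hj => ?_⟩
    rcases (show D < i ∨ D = i by omega) with h | rfl
    · exact (hB D h hu j hj).of_refines href3
    · exact hB3 hu j hj
  · rintro s2 hA ⟨h24, -⟩
    rw [h24, (hs1.of_agree hA (by decide) (by decide)).len, not_lt]
    have := Nat.lt_div_mul_add (a := m - 1) hw0
    rw [add_mul]
    exact_mod_cast (by omega)
  · rintro t s2 hA ht ⟨-, hO2, href, hB⟩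
    have hs2 := hs1.of_agree hA (by decide) (by decide)
    refine wp_seq (wp_arith ((2 ^ (S + 1) : ℕ) : ℝ) (by simp [hs2.width]; ring)
      (hV.nat (by rw [pow_succ, ← hw]; omega)) ?_)
    refine wp_arith ((S + 1 : ℕ) : ℝ) (by simp [hs2.level, hs2.one]) (hV.nat (by omega)) ?_
    refine ⟨?_, by simp, by simp, ?_, by simpa using hO2, ?_, ?_⟩
    · have hN : (m - 1) / w + 1 ≤ n := by
        have := Nat.div_le_self (m - 1) w
        have := hV.pos
        omega
      have hcard := card_used_le hd hf hF hw0
        ((Finset.range ((m - 1) / w + 1)).filter fun D => Used F m w (D * w))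
        (fun D hD => (Finset.mem_filter.1 hD).2)
      rw [Finset.sum_add_distrib, Finset.sum_add_distrib, ← Finset.sum_filter, Finset.sum_const,
        Finset.sum_const, Finset.sum_const, Finset.card_range, smul_eq_mul, smul_eq_mul,
        smul_eq_mul] at ht
      have h1 := Nat.mul_le_mul_right (64 * n * (S + 1) + 6) hcard
      have hn : 1 ≤ n := hV.pos.trans hmn
      have h2 : n ≤ d * n * (S + 1) := by
        calc n = 1 * n * 1 := by ring
          _ ≤ d * n * (S + 1) := Nat.mul_le_mul (Nat.mul_le_mul_right _ hd) (by omega)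
      have h3 : 12 * d * (64 * n * (S + 1) + 6) ≤ 840 * (d * n * (S + 1)) := by
        have : d ≤ d * n * (S + 1) := by
          calc d = d * 1 * 1 := by ring
            _ ≤ d * n * (S + 1) := Nat.mul_le_mul (Nat.mul_le_mul_left _ hn) (by omega)
        calc 12 * d * (64 * n * (S + 1) + 6) = 768 * (d * n * (S + 1)) + 72 * d := by ring
          _ ≤ _ := by omega
      have h4 : 900 * d * n * (S + 1) = 900 * (d * n * (S + 1)) := by ring
      omega
    · intro x hx
      simpa [hA.arr 7 rfl] using h1_7 x hx
    · rw [a1 2 (by decide)] at href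
      simpa using href
    · intro D hD hu i hi
      have := hB D (by
        have : D ≤ (m - 1) / w := (Nat.le_div_iff_mul_le hw0).2 (by omega)
        omega) hu i hi
      simpa using this

end Search

/-! ### Preprocessing and the complete program. -/

/-- Array `3` receives the values of the polynomial at `0, …, m - 1`, by Horner's rule. -/
def evalCmd : Cmd :=
  .const 5 0 ;; .whileLt 5 1
    (.const 6 0 ;; .arith .add 7 2 4 ;;
      .whileLt 3 7
        (.arith .sub 7 7 4 ;; .load 8 1 7 ;; .arith .mul 6 6 5 ;; .arith .add 6 6 8) ;;
      .store 3 5 6 ;; .arith .add 5 5 4)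

/-- The arrays `4` and `5` receive the numbers of convex and of concave positions. -/
def countCmd : Cmd :=
  .const 9 0 ;; .whileLt 9 1
    (.load 10 3 9 ;; .arith .add 13 9 4 ;; .load 11 3 13 ;; .load 14 4 13 ;; .load 15 5 13 ;;
      .arith .add 13 13 4 ;; .load 12 3 13 ;; .arith .add 10 10 12 ;; .arith .add 11 11 11 ;;
      .ifLt 11 10 (.arith .add 14 14 4) .skip ;; .ifLt 10 11 (.arith .add 15 15 4) .skip ;;
      .store 4 13 14 ;; .store 5 13 15 ;; .arith .add 9 9 4)

/-- The result is initialized with the terms for `i = 0`. -/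
def initCmd : Cmd :=
  .const 18 0 ;; .load 19 3 18 ;;
  .whileLt 18 0 (.load 8 0 18 ;; .arith .add 8 8 19 ;; .store 2 18 8 ;; .arith .add 18 18 4)

/-- The reduced convolution of the array `0` with the polynomial whose coefficients are in the
array `1`. -/
def mainCmd : Cmd :=
  .const 4 1 ;; evalCmd ;; countCmd ;; initCmd ;; .arith .sub 23 0 1 ;; .arith .add 23 23 4 ;;
  .arith .add 22 1 4 ;; levelsCmd

/-- The partial results of Horner's rule. -/
def horner (f : Polynomial ℤ) (d i k : ℕ) : ℤ :=
  ∑ l ∈ Finset.range (d + 1 - k), f.coeff (k + l) * (i : ℤ) ^ l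

theorem horner_eq (f : Polynomial ℤ) {d k : ℕ} (i : ℕ) (hk : k ≤ d) :
    horner f d i k = horner f d i (k + 1) * i + f.coeff k := by
  rw [horner, horner, show d + 1 - k = (d + 1 - (k + 1)) + 1 by omega, Finset.sum_range_succ',
    Finset.sum_mul]
  congr 1
  · refine Finset.sum_congr rfl fun l _ => ?_
    rw [show k + (l + 1) = k + 1 + l by ring, pow_succ, mul_assoc]
  · simp

theorem horner_zero {f : Polynomial ℤ} {d : ℕ} (hf : f.natDegree ≤ d) (i : ℕ) :
    horner f d i 0 = f.eval (i : ℤ) := by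
  rw [Polynomial.eval_eq_sum_range' (Nat.lt_succ_of_le hf)]
  simp [horner]

/-- The extra factor `n` accounts for the multiplication by `i` before the next coefficient is
added, so both intermediate values of a Horner step are bounded. -/
theorem abs_horner_mul_le (f : Polynomial ℤ) {d n i : ℕ} (hin : i ≤ n) (hn : 1 ≤ n) (k : ℕ) :
    |horner f d i k| * n ≤
      (∑ j ∈ Finset.range (d + 1), (f.coeff j).natAbs + 1 : ℕ) * (n : ℤ) ^ (d + 1) := by
  have h1 : |horner f d i k| ≤
      ∑ l ∈ Finset.range (d + 1 - k), |f.coeff (k + l)| * (n : ℤ) ^ d := by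
    refine (Finset.abs_sum_le_sum_abs _ _).trans (Finset.sum_le_sum fun l hl => ?_)
    rw [abs_mul, abs_pow, Nat.abs_cast]
    refine mul_le_mul_of_nonneg_left ?_ (abs_nonneg _)
    rw [Finset.mem_range] at hl
    calc (i : ℤ) ^ l ≤ (n : ℤ) ^ l := pow_le_pow_left₀ (by positivity) (by exact_mod_cast hin) _
      _ ≤ (n : ℤ) ^ d := pow_le_pow_right₀ (by exact_mod_cast hn) (by omega)
  have h2 : ∑ l ∈ Finset.range (d + 1 - k), |f.coeff (k + l)| ≤
      ∑ j ∈ Finset.range (d + 1), |f.coeff j| := by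
    rw [← Finset.sum_Ico_eq_sum_range (fun j => |f.coeff j|)]
    refine Finset.sum_le_sum_of_subset_of_nonneg (fun x hx => ?_) fun _ _ _ => abs_nonneg _
    simp only [Finset.mem_Ico, Finset.mem_range] at hx ⊢
    exact hx.2
  have h3 : ((∑ j ∈ Finset.range (d + 1), (f.coeff j).natAbs + 1 : ℕ) : ℤ) =
      ∑ j ∈ Finset.range (d + 1), |f.coeff j| + 1 := by
    push_cast [Int.natCast_natAbs]; rfl
  rw [← Finset.sum_mul] at h1
  rw [h3, pow_succ, ← mul_assoc]
  refine mul_le_mul_of_nonneg_right (h1.trans (mul_le_mul_of_nonneg_right ?_ ?_)) ?_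
  · omega
  · positivity
  · positivity

theorem intBound_eq (d n : ℕ) (f : Polynomial ℤ) : (intBound d n f : ℤ) =
    16 * ((∑ j ∈ Finset.range (d + 1), (f.coeff j).natAbs + 1 : ℕ) * (n : ℤ) ^ (d + 1)) := by
  rw [intBound]; push_cast; ring

theorem le_intBound (d : ℕ) {n : ℕ} (hn : 1 ≤ n) (f : Polynomial ℤ) :
    8 * n + 8 ≤ intBound d n f := by
  have h : n ≤ n ^ (d + 1) := Nat.le_self_pow (by omega) n
  rw [intBound]
  have := Nat.mul_le_mul (Nat.le_add_left 1 (∑ j ∈ Finset.range (d + 1), (f.coeff j).natAbs)) h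
  rw [mul_assoc]
  omega

theorem succ_le_intBound (d : ℕ) {n : ℕ} (hn : 2 ≤ n) (f : Polynomial ℤ) :
    d + 1 ≤ intBound d n f := by
  have h : d + 1 ≤ n ^ (d + 1) := (Nat.lt_pow_self (show 1 < n by omega)).le
  rw [intBound]
  exact h.trans (Nat.le_mul_of_pos_left _ (by positivity))

/-- The values of the polynomial `f` at `0, …, m - 1`, followed by zeros. -/
noncomputable def values (f : Polynomial ℤ) (m i : ℕ) : ℤ := if i < m then f.eval (i : ℤ) else 0

/-- The factor `16` leaves room for the sums of two values in the second differences. -/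
theorem abs_values_le {f : Polynomial ℤ} {d n m : ℕ} (hf : f.natDegree ≤ d) (hmn : m ≤ n)
    (hn : 1 ≤ n) (i : ℕ) : 16 * |values f m i| ≤ intBound d n f := by
  rw [values]
  split_ifs with hi
  · rw [← horner_zero hf, intBound_eq]
    have h1 := abs_horner_mul_le (d := d) f (show i ≤ n by omega) hn 0
    have h2 : |horner f d i 0| * 1 ≤ |horner f d i 0| * n :=
      mul_le_mul_of_nonneg_left (by exact_mod_cast hn) (abs_nonneg _)
    omega
  · simp

section Run

variable {V : ℝ → Prop} {d n m : ℕ} {f : Polynomial ℤ} {A : ℕ → ℝ} {s : State}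

theorem wp_eval (hV : Admissible V (intBound d n f) n m A fun i => values f m i)
    (hf : f.natDegree ≤ d) (hmn : m ≤ n) (hn : 2 ≤ n) (h1 : s.reg 1 = m)
    (h2 : s.reg 2 = d) (h3 : s.reg 3 = 0) (h4 : s.reg 4 = 1) (a1 : ∀ i, s.arr 1 i = f.coeff i)
    (a3 : ∀ i, s.arr 3 i = 0) :
    wp V evalCmd s fun t s' => t ≤ m * (5 * d + 11) + 2 ∧ ∀ i, s'.arr 3 i = values f m i := by
  have hB := intBound_eq d n f
  have hd : ∀ k ≤ d + 1, V (k : ℝ) := fun k hk => by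
    have := hV.int k (by rw [Nat.abs_cast]; exact_mod_cast hk.trans (succ_le_intBound d hn f))
    simpa using this
  refine wp_seq (wp_const (by simpa using hV.nat (Nat.zero_le _)) ?_)
  -- Cells not yet filled hold their initial zeros, so after `i` rounds the whole array is `values f
  -- i`.
  refine wp_whileLt m (fun i s' => s'.reg 5 = i ∧ ∀ x, s'.arr 3 x = values f i x)
    (fun _ => 5 * d + 10) ⟨by simp, by simpa [values] using a3⟩ ?_ ?_ ?_
  · rintro i hi s1 hA ⟨h5, hv⟩
    have e1 : s1.reg 1 = m := by rw [hA.reg _ rfl]; simpa using h1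
    have e2 : s1.reg 2 = d := by rw [hA.reg _ rfl]; simpa using h2
    have e3 : s1.reg 3 = 0 := by rw [hA.reg _ rfl]; simpa using h3
    have e4 : s1.reg 4 = 1 := by rw [hA.reg _ rfl]; simpa using h4
    have ea1 : ∀ i, s1.arr 1 i = f.coeff i := by rw [hA.arr _ rfl]; simpa using a1
    refine ⟨by rw [h5, e1]; exact_mod_cast hi, ?_⟩
    refine wp_seq (wp_const (by simpa using hV.nat (Nat.zero_le _)) ?_)
    refine wp_seq (wp_arith ((d + 1 : ℕ) : ℝ) (by simp [e2, e4]) (hd _ le_rfl) ?_)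
    refine wp_seq (wp_whileLt (d + 1) (fun j s' => s'.reg 7 = (d + 1 - j : ℕ) ∧
      s'.reg 6 = horner f d i (d + 1 - j)) (fun _ => 4) ⟨by simp, by simp [horner]⟩ ?_ ?_ ?_)
    · rintro j hj s2 hA2 ⟨h7, h6⟩
      have g3 : s2.reg 3 = 0 := by rw [hA2.reg _ rfl]; simpa using e3
      have g4 : s2.reg 4 = 1 := by rw [hA2.reg _ rfl]; simpa using e4
      have g5 : s2.reg 5 = i := by rw [hA2.reg _ rfl]; simpa using h5
      have ga1 : ∀ i, s2.arr 1 i = f.coeff i := by rw [hA2.arr _ rfl]; simpa using ea1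
      refine ⟨by rw [h7, g3]; exact_mod_cast (by omega), ?_⟩
      obtain ⟨k, hk⟩ : ∃ k, d + 1 - j = k + 1 := ⟨d - j, by omega⟩
      have hk' : d + 1 - (j + 1) = k := by omega
      rw [hk] at h7 h6
      rw [hk']
      have b1 := abs_horner_mul_le (d := d) f (show i ≤ n by omega) (by omega) k
      have b2 := abs_horner_mul_le (d := d) f (show i ≤ n by omega) (by omega) (k + 1)
      have b3 : |horner f d i k| * 1 ≤ |horner f d i k| * n :=
        mul_le_mul_of_nonneg_left (by exact_mod_cast (by omega)) (abs_nonneg _)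
      have b4 : |horner f d i (k + 1)| * i ≤ |horner f d i (k + 1)| * n :=
        mul_le_mul_of_nonneg_left (by exact_mod_cast (by omega)) (abs_nonneg _)
      have b5 := abs_nonneg (horner f d i k)
      have b6 : 0 ≤ |horner f d i (k + 1)| * (i : ℤ) := by positivity
      refine wp_seq (wp_arith (k : ℝ) (by simp [h7, g4]) (hd k (by omega)) ?_)
      refine wp_seq (wp_load k (by simp) ?_)
      refine wp_seq (wp_arith ((horner f d i (k + 1) * i : ℤ) : ℝ) (by simp [h6, g5])
        (hV.int _ (by rw [abs_mul, Nat.abs_cast]; omega)) ?_)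
      refine wp_arith ((horner f d i k : ℤ) : ℝ) ?_ (hV.int _ (by omega)) ?_
      · rw [horner_eq f i (by omega : k ≤ d)]; simp [ga1]
      · exact ⟨by omega, by simp, by simp⟩
    · rintro s2 hA2 ⟨h7, -⟩
      rw [h7, hA2.reg 3 rfl]
      simp [e3]
    · rintro t s2 hA2 ht ⟨-, h6⟩
      rw [Nat.sub_self, horner_zero hf] at h6
      have g4 : s2.reg 4 = 1 := by rw [hA2.reg _ rfl]; simpa using e4
      have g5 : s2.reg 5 = i := by rw [hA2.reg _ rfl]; simpa using h5
      have ga3 : s2.arr 3 = s1.arr 3 := by rw [hA2.arr _ rfl]; rfl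
      refine wp_seq (wp_store i g5 ?_)
      refine wp_arith ((i + 1 : ℕ) : ℝ) (by simp [g4, g5]) (hV.nat (by omega)) ?_
      refine ⟨by simp at ht; omega, by simp, fun x => ?_⟩
      by_cases hx : x = i
      · subst hx; simp [h6, values]
      · have : x < i + 1 ↔ x < i := by omega
        simp [hx, ga3, hv, values, this]
  · rintro s1 hA ⟨h5, -⟩
    rw [h5, hA.reg 1 rfl]
    simp [h1]
  · rintro t s1 hA ht ⟨-, hv⟩
    refine ⟨?_, by simpa using hv⟩
    rw [Finset.sum_const, Finset.card_range, smul_eq_mul] at ht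
    exact (Nat.add_le_add_left ht 1).trans (by ring_nf; omega)

/-- The last rounds read the zeros beyond the domain of the sequence. The positions counted there
lie in no interval with upper end below `m`, so the tests are not affected. -/
theorem wp_count {F : ℕ → ℝ} (hV : Admissible V (intBound d n f) n m A F)
    (hF : ∀ i, F i = values f m i) (hf : f.natDegree ≤ d) (h1 : s.reg 1 = m) (h4 : s.reg 4 = 1)
    (a3 : s.arr 3 = F) (a4 : ∀ i, s.arr 4 i = 0) (a5 : ∀ i, s.arr 5 i = 0) :
    wp V countCmd s fun t s' => t ≤ 18 * m + 2 ∧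
      (∀ x ≤ m, s'.arr 4 x = convexCount F (x - 1)) ∧
      ∀ x ≤ m, s'.arr 5 x = concaveCount F (x - 1) := by
  classical
  have hmn := hV.m_le
  have hm := hV.pos
  refine wp_seq (wp_const (by simpa using hV.nat (Nat.zero_le _)) ?_)
  -- The cells `0` and `1` both hold the empty count; round `i` writes cell `i + 2`.
  refine wp_whileLt m (fun i s' => s'.reg 9 = i ∧
    (∀ x ≤ i + 1, s'.arr 4 x = convexCount F (x - 1)) ∧
    ∀ x ≤ i + 1, s'.arr 5 x = concaveCount F (x - 1))
    (fun _ => 17) ⟨by simp, ?_, ?_⟩ ?_ ?_ ?_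
  · intro x hx
    rw [show x - 1 = 0 by omega]
    simpa [convexCount] using a4 x
  · intro x hx
    rw [show x - 1 = 0 by omega]
    simpa [concaveCount] using a5 x
  · rintro i hi s1 hA ⟨h9, hp, hq⟩
    have e1 : s1.reg 1 = m := by rw [hA.reg _ rfl]; simpa using h1
    have e4 : s1.reg 4 = 1 := by rw [hA.reg _ rfl]; simpa using h4
    have ea3 : s1.arr 3 = F := by rw [hA.arr _ rfl]; simpa using a3
    have hF2 : ∀ x y, V (F x + F y) := fun x y => by
      have hx := abs_values_le (n := n) hf hmn (by omega) x
      have hy := abs_values_le (n := n) hf hmn (by omega) y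
      have := hV.int (values f m x + values f m y) ((abs_add_le _ _).trans (by omega))
      rw [hF, hF]; simpa using this
    have hp' := hp (i + 1) le_rfl
    have hq' := hq (i + 1) le_rfl
    rw [Nat.add_sub_cancel] at hp' hq'
    have hpi : convexCount F i ≤ i := Nat.count_le _
    have hqi : concaveCount F i ≤ i := Nat.count_le _
    refine ⟨by rw [h9, e1]; exact_mod_cast hi, ?_⟩
    refine wp_seq (wp_load i h9 ?_)
    refine wp_seq (wp_arith ((i + 1 : ℕ) : ℝ) (by simp [h9, e4]) (hV.nat (by omega)) ?_)
    refine wp_seq (wp_load (i + 1) (by simp) ?_)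
    refine wp_seq (wp_load (i + 1) (by simp) ?_)
    refine wp_seq (wp_load (i + 1) (by simp) ?_)
    refine wp_seq (wp_arith ((i + 2 : ℕ) : ℝ) (by simp [e4]; ring) (hV.nat (by omega)) ?_)
    refine wp_seq (wp_load (i + 2) (by simp) ?_)
    refine wp_seq (wp_arith (F i + F (i + 2)) (by simp [ea3]) (hF2 _ _) ?_)
    refine wp_seq (wp_arith (F (i + 1) + F (i + 1)) (by simp [ea3]) (hF2 _ _) ?_)
    set s2 := State.setReg _ 11 _ with hs2d
    have g9 : s2.reg 9 = i := by simp [hs2d, h9]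
    have g4 : s2.reg 4 = 1 := by simp [hs2d, e4]
    have g13 : s2.reg 13 = (i + 2 : ℕ) := by simp [hs2d]
    have g10 : s2.reg 10 = F i + F (i + 2) := by simp [hs2d]
    have g11 : s2.reg 11 = F (i + 1) + F (i + 1) := by simp [hs2d]
    have g14 : s2.reg 14 = convexCount F i := by simp [hs2d, hp']
    have g15 : s2.reg 15 = concaveCount F i := by simp [hs2d, hq']
    have ga : s2.arr = s1.arr := rfl
    clear_value s2
    have hfin : ∀ (T : ℕ) (s3 : State), T ≤ 14 → s3.reg 9 = i → s3.reg 4 = 1 →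
        s3.reg 13 = (i + 2 : ℕ) → s3.arr = s1.arr → s3.reg 14 = convexCount F (i + 1) →
        s3.reg 15 = concaveCount F (i + 1) →
        wp V (.store 4 13 14 ;; .store 5 13 15 ;; .arith .add 9 9 4) s3 fun t s' =>
          T + t ≤ 17 ∧ s'.reg 9 = (i + 1 : ℕ) ∧
            (∀ x ≤ i + 1 + 1, s'.arr 4 x = convexCount F (x - 1)) ∧
            ∀ x ≤ i + 1 + 1, s'.arr 5 x = concaveCount F (x - 1) := by
      intro T s3 hT k9 k4 k13 ka k14 k15
      refine wp_seq (wp_store (i + 2) k13 ?_)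
      refine wp_seq (wp_store (i + 2) (by simpa using k13) ?_)
      refine wp_arith ((i + 1 : ℕ) : ℝ) (by simp [k9, k4]) (hV.nat (by omega)) ?_
      refine ⟨by omega, by simp, fun x hx => ?_, fun x hx => ?_⟩
      · by_cases hx' : x = i + 2
        · subst hx'; simp [k14]
        · simp [hx', ka, hp x (by omega)]
      · by_cases hx' : x = i + 2
        · subst hx'; simp [k15]
        · simp [hx', ka, hq x (by omega)]
    have c1 : convexCount F (i + 1) = convexCount F i +
        if F (i + 1) + F (i + 1) < F i + F (i + 2) then 1 else 0 := by
      rw [convexCount, Nat.count_succ]; rfl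
    have c2 : concaveCount F (i + 1) = concaveCount F i +
        if F i + F (i + 2) < F (i + 1) + F (i + 1) then 1 else 0 := by
      rw [concaveCount, Nat.count_succ]; rfl
    refine wp_seq (wp_ifLt (fun hlt => ?_) (fun hge => wp_skip ?_))
    · rw [g11, g10] at hlt
      rw [if_pos hlt] at c1
      rw [if_neg hlt.not_gt, add_zero] at c2
      refine wp_arith ((convexCount F (i + 1) : ℕ) : ℝ) (by simp [g14, g4, c1])
        (hV.nat (by omega)) ?_
      refine wp_seq (wp_ifLt (fun hlt' => ?_) (fun hge' => wp_skip ?_))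
      · simp [g10, g11] at hlt'
        exact absurd hlt' hlt.not_gt
      · exact (hfin 13 _ (by omega) (by simpa using g9) (by simpa using g4) (by simpa using g13)
          (by simp [ga]) (by simp) (by simp [g15, c2])).mono
          fun t s' _ h => ⟨by have := h.1; omega, h.2⟩
    · rw [g11, g10] at hge
      rw [if_neg hge, add_zero] at c1
      refine wp_seq (wp_ifLt (fun hlt' => ?_) (fun hge' => wp_skip ?_))
      · rw [g11, g10] at hlt'
        rw [if_pos hlt'] at c2
        refine wp_arith ((concaveCount F (i + 1) : ℕ) : ℝ) (by simp [g15, g4, c2])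
          (hV.nat (by omega)) ?_
        exact (hfin 13 _ (by omega) (by simpa using g9) (by simpa using g4) (by simpa using g13)
          (by simp [ga]) (by simp [g14, c1]) (by simp)).mono
          fun t s' _ h => ⟨by have := h.1; omega, h.2⟩
      · rw [g11, g10] at hge'
        rw [if_neg hge', add_zero] at c2
        exact (hfin 13 _ (by omega) g9 g4 g13 ga (by rw [g14, c1]) (by rw [g15, c2])).mono
          fun t s' _ h => ⟨by have := h.1; omega, h.2⟩
  · rintro s1 hA ⟨h9, -⟩
    rw [h9, hA.reg 1 rfl]
    simp [h1]
  · rintro t s1 hA ht ⟨-, hp, hq⟩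
    exact ⟨by simp at ht; omega, fun x hx => hp x (by omega), fun x hx => hq x (by omega)⟩

/-- Starting from a genuine term instead of an infinite value makes every later entry an attained
one. All `n` cells are filled, including those past `n - m` that the last squares touch. -/
theorem wp_init {B : ℕ} {F : ℕ → ℝ} (hV : Admissible V B n m A F) (h0 : s.reg 0 = n)
    (h4 : s.reg 4 = 1) (a0 : s.arr 0 = A) (a3 : s.arr 3 = F) :
    wp V initCmd s fun t s' => t ≤ 5 * n + 3 ∧ ∀ k < n, s'.arr 2 k = A k + F 0 := by
  refine wp_seq (wp_const (by simpa using hV.nat (Nat.zero_le _)) ?_)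
  refine wp_seq (wp_load 0 (by simp) ?_)
  refine wp_whileLt n (fun i s' => s'.reg 18 = i ∧ ∀ k < i, s'.arr 2 k = A k + F 0)
    (fun _ => 4) ⟨by simp, fun k hk => by omega⟩ ?_ ?_ ?_
  · rintro i hi s1 hA ⟨h18, hC⟩
    have e0 : s1.reg 0 = n := by rw [hA.reg _ rfl]; simpa using h0
    have e4 : s1.reg 4 = 1 := by rw [hA.reg _ rfl]; simpa using h4
    have e19 : s1.reg 19 = F 0 := by rw [hA.reg _ rfl]; simp [a3]
    have ea : s1.arr 0 = A := by rw [hA.arr _ rfl]; simpa using a0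
    refine ⟨by rw [h18, e0]; exact_mod_cast hi, ?_⟩
    refine wp_seq (wp_load i h18 ?_)
    refine wp_seq (wp_arith (A i + F 0) (by simp [ea, e19]) (hV.add _ _ hV.pos) ?_)
    refine wp_seq (wp_store i (by simpa using h18) ?_)
    refine wp_arith ((i + 1 : ℕ) : ℝ) (by simp [h18, e4]) (hV.nat (by omega)) ?_
    refine ⟨le_rfl, by simp, fun k hk => ?_⟩
    by_cases hki : k = i
    · subst hki; simp
    · simp [hki, hC k (by omega)]
  · rintro s1 hA ⟨h18, -⟩
    rw [h18, hA.reg 0 rfl]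
    simp [h0]
  · rintro t s1 hA ht ⟨-, hC⟩
    exact ⟨by simp at ht; omega, hC⟩

/-- The sides double from `1` up to at most `m`. The machine cannot divide by two, so each level
records its side in array `7`, from which the decreasing strides are read. -/
theorem wp_levels {B : ℕ} {F : ℕ → ℝ} (hV : Admissible V B n m A F) (hs : SearchState A F n m s)
    (hd : 1 ≤ d) (hf : f.natDegree ≤ d) (hF : ∀ i < m, F i = (f.eval (i : ℤ) : ℤ))
    (h22 : s.reg 22 = (m + 1 : ℕ)) (hO : ∃ O : ℕ → ℕ, ∀ x, s.arr 6 x = O x) :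
    wp V levelsCmd s fun t s' =>
      t ≤ (Nat.log 2 m + 1) * (900 * d * n * (Nat.log 2 m + 1) + 1) + 3 ∧
      Refines A F m (s.arr 2) (s'.arr 2) ∧
      ∀ k, k + m ≤ n → ∀ i < m, s'.arr 2 k ≤ A (k + i) + F i := by
  have hm := hV.pos
  refine wp_seq (wp_const (by simpa using hV.nat (show 1 ≤ 8 * n + 8 by omega)) ?_)
  refine wp_seq (wp_const (by simpa using hV.nat (Nat.zero_le _)) ?_)
  have hs0 : SearchState A F n m ((s.setReg 20 ((1 : ℤ) : ℝ)).setReg 21 ((0 : ℤ) : ℝ)) :=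
    hs.congr (fun x hx => by
      simp only [List.mem_cons, List.not_mem_nil, or_false] at hx
      rcases hx with rfl | rfl | rfl | rfl <;> simp) fun x _ => rfl
  refine wp_whileLt (Nat.log 2 m + 1) (fun S s' => s'.reg 20 = (2 ^ S : ℕ) ∧ s'.reg 21 = S ∧
    (∀ x < S, s'.arr 7 x = (2 ^ x : ℕ)) ∧ (∃ O : ℕ → ℕ, ∀ x, s'.arr 6 x = O x) ∧
    Refines A F m (s.arr 2) (s'.arr 2) ∧
    ∀ S' < S, BelowLevel A F (s'.arr 2) n m (2 ^ S'))
    (fun S => 900 * d * n * (S + 1))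
    ⟨by simp, by simp, fun x hx => by omega, by simpa using hO,
      by simpa using Refines.refl _ _ _ _, fun x hx => by omega⟩ ?_ ?_ ?_
  · rintro S hS s1 hA ⟨h20, h21, h7, hO1, href, hB⟩
    have hs1 := hs0.of_agree hA (by decide) (by decide)
    have hSm : 2 ^ S ≤ m := Nat.pow_le_of_le_log (by omega) (by omega)
    refine ⟨?_, ?_⟩
    · rw [h20, hA.reg 22 rfl]
      simp only [State.setReg_reg]
      simp only [Nat.reduceEqDiff, if_false, h22]
      exact_mod_cast Nat.lt_succ_of_le hSm
    refine (wp_level hV hs1 hd hf hF h20 h21 hSm h7 hO1).mono ?_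
    rintro t s2 - ⟨ht, h20', h21', h7', hO2, href2, hB2⟩
    refine ⟨ht, h20', h21', h7', hO2, href.trans href2, fun S' hS' => ?_⟩
    rcases (show S' < S ∨ S' = S by omega) with h | rfl
    · exact (hB S' h).of_refines href2
    · exact hB2
  · rintro s1 hA ⟨h20, -⟩
    rw [h20, hA.reg 22 rfl, not_lt]
    simp only [State.setReg_reg, Nat.reduceEqDiff, if_false, h22]
    exact_mod_cast Nat.lt_pow_succ_log_self (by norm_num) m
  · rintro t s1 hA ht ⟨-, -, -, -, href, hB⟩
    refine ⟨?_, href, fun k hk i hi => le_of_belowLevel (fun S hS => hB S ?_) hk hi⟩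
    · have := Finset.sum_le_card_nsmul (Finset.range (Nat.log 2 m + 1))
        (fun S => 900 * d * n * (S + 1) + 1) (900 * d * n * (Nat.log 2 m + 1) + 1)
        fun S hS => by
          rw [Finset.mem_range] at hS
          exact Nat.add_le_add_right (Nat.mul_le_mul_left _ (by omega)) _
      rw [Finset.card_range, smul_eq_mul] at this
      omega
    · exact Nat.lt_succ_of_le (Nat.le_log_of_pow_le (by norm_num) hS)

end Run

/-! ### Comparison with the required bound. -/

/-- With `x = log₂ d`, the difference of the two sides is `x ^ 2 / (1 + x)`. Consequently the
exponent of `n` in the bound is at least one. -/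
theorem one_le_sigma {d : ℕ} (hd : 1 ≤ d) : 1 ≤ sigma d := by
  have h : 0 ≤ Real.logb 2 d := Real.logb_nonneg (by norm_num) (by exact_mod_cast hd)
  rw [sigma]
  generalize Real.logb 2 d = x at h
  have hx : (0 : ℝ) < 1 + x := by linarith
  rw [← sub_nonneg, show x + 1 / (1 + x) - 1 = x ^ 2 / (1 + x) by field_simp; ring]
  positivity

/-- The summand `1` is at most `Nat.log 2 n`, and `log 2 > 1 / 2`. -/
theorem log_succ_le {n : ℕ} (hn : 2 ≤ n) : ((Nat.log 2 n + 1 : ℕ) : ℝ) ≤ 4 * Real.log n := by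
  have h1 : 1 ≤ Nat.log 2 n := Nat.log_pos (by norm_num) hn
  have h2 : (Nat.log 2 n : ℝ) * Real.log 2 ≤ Real.log n := by
    rw [← Real.log_pow]
    refine Real.log_le_log (by positivity) ?_
    exact_mod_cast Nat.pow_log_le_self 2 (by omega)
  have h3 := Real.log_two_gt_d9
  have h4 : (1 : ℝ) ≤ Nat.log 2 n := by exact_mod_cast h1
  push_cast
  nlinarith

theorem nearly_linear_le_bound {d n : ℕ} (hd : 1 ≤ d) (hn : 2 ≤ n) :
    ((1000 * (d * n * (Nat.log 2 n + 1) ^ 2) : ℕ) : ℝ) ≤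
      16000 * (d : ℝ) ^ 3 * (n : ℝ) ^ (1 + (sigma d - 1) / sigma d) * (Real.log n) ^ 2 := by
  have hσ := one_le_sigma hd
  have h1 : (n : ℝ) ≤ (n : ℝ) ^ (1 + (sigma d - 1) / sigma d) := by
    conv_lhs => rw [← Real.rpow_one (n : ℝ)]
    refine Real.rpow_le_rpow_of_exponent_le (by exact_mod_cast (by omega)) ?_
    have : 0 ≤ (sigma d - 1) / sigma d := div_nonneg (by linarith) (by linarith)
    linarith
  have h2 : (d : ℝ) ≤ (d : ℝ) ^ 3 := le_self_pow₀ (by exact_mod_cast hd) (by norm_num)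
  -- The passage to the natural logarithm turns the constant `1000` into `16000`.
  have h3 : ((Nat.log 2 n + 1 : ℕ) : ℝ) ^ 2 ≤ 16 * (Real.log n) ^ 2 := by
    calc _ ≤ (4 * Real.log n) ^ 2 := pow_le_pow_left₀ (by positivity) (log_succ_le hn) 2
      _ = _ := by ring
  calc ((1000 * (d * n * (Nat.log 2 n + 1) ^ 2) : ℕ) : ℝ)
      = 1000 * ((d : ℝ) * n * ((Nat.log 2 n + 1 : ℕ) : ℝ) ^ 2) := by push_cast; ring
    _ ≤ 1000 * ((d : ℝ) ^ 3 * (n : ℝ) ^ (1 + (sigma d - 1) / sigma d) *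
        (16 * (Real.log n) ^ 2)) := by gcongr
    _ = _ := by ring

/-! ### Assembly. -/

theorem admissible_smallValue {d n m : ℕ} (hd : 1 ≤ d) (hn : 2 ≤ n) (hm : 1 ≤ m) (hmn : m ≤ n)
    {f : Polynomial ℤ} (hf : f.natDegree ≤ d) (a : Fin n → ℝ) :
    Admissible (SmallValue d n m f a) (intBound d n f) n m
      (fun i => if h : i < n then a ⟨i, h⟩ else 0) (fun i => values f m i) where
  int z hz := smallValue_int hd z hz
  add j i _ := by
    have hv := abs_values_le hf hmn (by omega) i
    have := abs_nonneg (values f m i)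
    split_ifs with h
    · exact smallValue_add hd _ _ (by omega)
    · rw [zero_add]; exact smallValue_int hd _ (by omega)
  le := le_intBound d (by omega) f
  pos := hm
  m_le := hmn

theorem wp_main {d n m : ℕ} (hd : 1 ≤ d) (hn : 2 ≤ n) (hm : 1 ≤ m) (hmn : m ≤ n)
    {f : Polynomial ℤ} (hf : f.natDegree ≤ d) (a : Fin n → ℝ) :
    wp (SmallValue d n m f a) mainCmd (inputState d n m f a) fun t s' =>
      t ≤ 1000 * (d * n * (Nat.log 2 n + 1) ^ 2) ∧
      IsReducedMinConv a (fun i : Fin m => ((f.eval ((i : ℕ) : ℤ) : ℤ) : ℝ)) (s'.arr 2) := by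
  have hV := admissible_smallValue hd hn hm hmn hf a
  set A : ℕ → ℝ := fun i => if h : i < n then a ⟨i, h⟩ else 0 with hA
  set F : ℕ → ℝ := fun i => values f m i with hF
  have hFm : ∀ i < m, F i = (f.eval (i : ℤ) : ℤ) := fun i hi => by simp [hF, values, hi]
  set s0 := inputState d n m f a with hs0
  have i0 : s0.reg 0 = n := rfl
  have i1 : s0.reg 1 = m := rfl
  have i2 : s0.reg 2 = d := rfl
  have i3 : s0.reg 3 = 0 := rfl
  have ia0 : s0.arr 0 = A := rfl
  have ia1 : ∀ i, s0.arr 1 i = f.coeff i := fun i => rfl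
  have ia : ∀ x, 2 ≤ x → ∀ i, s0.arr x i = 0 := fun x hx i => by
    simp only [hs0, inputState]
    rw [if_neg (by omega), if_neg (by omega)]
  clear_value s0
  refine wp_seq (wp_const (by simpa using hV.nat (show 1 ≤ 8 * n + 8 by omega)) ?_)
  set s1 := State.setReg s0 4 _ with hs1d
  have r1 : ∀ x, x ≠ 4 → s1.reg x = s0.reg x := fun x hx => by simp [hs1d, hx]
  have h1_4 : s1.reg 4 = 1 := by simp [hs1d]
  have a1 : s1.arr = s0.arr := rfl
  clear_value s1
  refine wp_seq ((wp_eval hV hf hmn hn (by rw [r1 _ (by decide), i1]) (by rw [r1 _ (by decide), i2])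
    (by rw [r1 _ (by decide), i3]) h1_4 (by rw [a1]; exact ia1)
    (by rw [a1]; exact ia 3 (by omega))).mono ?_)
  rintro t2 s2 hA2 ⟨ht2, h2⟩
  have h2F : s2.arr 3 = F := funext h2
  refine wp_seq ((wp_count hV (fun _ => rfl) hf
    (by rw [hA2.reg _ rfl, r1 _ (by decide), i1]) (by rw [hA2.reg _ rfl, h1_4]) h2F
    (by rw [hA2.arr _ rfl, a1]; exact ia 4 (by omega))
    (by rw [hA2.arr _ rfl, a1]; exact ia 5 (by omega))).mono ?_)
  rintro t3 s3 hA3 ⟨ht3, h3p, h3q⟩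
  refine wp_seq ((wp_init hV
    (by rw [hA3.reg _ rfl, hA2.reg _ rfl, r1 _ (by decide), i0])
    (by rw [hA3.reg _ rfl, hA2.reg _ rfl, h1_4])
    (by rw [hA3.arr _ rfl, hA2.arr _ rfl, a1, ia0])
    (by rw [hA3.arr _ rfl, h2F])).mono ?_)
  rintro t4 s4 hA4 ⟨ht4, h4C⟩
  have r4 : ∀ x ∈ [0, 1, 3], s4.reg x = s0.reg x := by
    intro x hx
    simp only [List.mem_cons, List.not_mem_nil, or_false] at hx
    rcases hx with rfl | rfl | rfl <;>
      rw [hA4.reg _ rfl, hA3.reg _ rfl, hA2.reg _ rfl, r1 _ (by decide)]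
  have h4_0 : s4.reg 0 = n := by rw [r4 _ (by simp), i0]
  have h4_1 : s4.reg 1 = m := by rw [r4 _ (by simp), i1]
  have h4_3 : s4.reg 3 = 0 := by rw [r4 _ (by simp), i3]
  have h4_4 : s4.reg 4 = 1 := by rw [hA4.reg _ rfl, hA3.reg _ rfl, hA2.reg _ rfl, h1_4]
  refine wp_seq (wp_arith ((n - m : ℕ) : ℝ) (by simp [h4_0, h4_1, Nat.cast_sub hmn])
    (hV.nat (by omega)) ?_)
  refine wp_seq (wp_arith ((n - m + 1 : ℕ) : ℝ) (by simp [h4_4]) (hV.nat (by omega)) ?_)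
  refine wp_seq (wp_arith ((m + 1 : ℕ) : ℝ) (by simp [h4_1, h4_4]) (hV.nat (by omega)) ?_)
  set s5 := State.setReg _ 22 _ with hs5d
  have a5 : s5.arr = s4.arr := rfl
  have h5 : SearchState A F n m s5 :=
    { zero := by simp [hs5d, h4_3]
      one := by simp [hs5d, h4_4]
      len := by simp [hs5d, h4_1]
      rows := by simp [hs5d]
      arrA := by rw [a5, hA4.arr _ rfl, hA3.arr _ rfl, hA2.arr _ rfl, a1, ia0]
      arrF := by rw [a5, hA4.arr _ rfl, hA3.arr _ rfl, h2F]
      convex := by rw [a5, hA4.arr _ rfl]; exact h3p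
      concave := by rw [a5, hA4.arr _ rfl]; exact h3q }
  have h5_22 : s5.reg 22 = (m + 1 : ℕ) := by simp [hs5d]
  have h5O : ∃ O : ℕ → ℕ, ∀ x, s5.arr 6 x = O x :=
    ⟨fun _ => 0, by
      rw [a5, hA4.arr _ rfl, hA3.arr _ rfl, hA2.arr _ rfl, a1]; simpa using ia 6 (by omega)⟩
  clear_value s5
  refine (wp_levels hV h5 hd hf hFm h5_22 h5O).mono ?_
  rintro t6 s6 - ⟨ht6, href, hC⟩
  rw [a5] at href
  refine ⟨?_, fun k hk => ⟨?_, ?_⟩⟩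
  -- The levels account for `900` of the constant `1000`; the preprocessing is linear in `d * n` and
  -- fits into the rest.
  · have hN : Nat.log 2 m ≤ Nat.log 2 n := Nat.log_mono_right hmn
    set N := Nat.log 2 n + 1 with hNd
    have hN1 : 1 ≤ N := by omega
    have hdn : 1 ≤ d * n := Nat.mul_pos hd (by omega)
    have e1 : n ≤ d * n := Nat.le_mul_of_pos_left _ hd
    have e2 : d * n ≤ d * n * N ^ 2 := Nat.le_mul_of_pos_right _ (by positivity)
    have e3 : N ≤ d * n * N ^ 2 := by
      calc N = 1 * N := (one_mul _).symm
        _ ≤ d * n * N ^ 2 := Nat.mul_le_mul hdn (Nat.le_self_pow (by norm_num) N)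
    have e4 : (Nat.log 2 m + 1) * (900 * d * n * (Nat.log 2 m + 1) + 1) ≤
        N * (900 * d * n * N + 1) :=
      Nat.mul_le_mul (by omega) (Nat.add_le_add_right (Nat.mul_le_mul_left _ (by omega)) _)
    have e5 : N * (900 * d * n * N + 1) = 900 * (d * n * N ^ 2) + N := by ring
    have e6 : m * (5 * d + 11) ≤ 16 * (d * n) := by
      calc m * (5 * d + 11) ≤ n * (16 * d) := Nat.mul_le_mul hmn (by omega)
        _ = _ := by ring
    omega
  · have hinit := h4C k (by omega)
    -- A cell that was never lowered still holds the term with `i = 0`.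
    have key : ∃ i < m, s6.arr 2 k = A (k + i) + F i := by
      rcases (href k).2 with h | h
      · exact ⟨0, hm, by rw [h, hinit, add_zero]⟩
      · exact h
    obtain ⟨i, hi, hk6⟩ := key
    refine ⟨⟨i, hi⟩, ?_⟩
    rw [hk6, hFm i hi]
    simp only [hA]
    rw [dif_pos (show k + i < n by omega)]
  · rintro _ ⟨i, rfl⟩
    have := hC k hk i i.2
    rw [hFm i i.2] at this
    simp only [hA] at this
    rwa [dif_pos (show k + i < n by omega)] at this

end MinConv

theorem theorem2 :
    ∃ (P : RealRAM.Cmd) (C : ℝ) (K e : ℕ),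
      ∀ (d n m : ℕ), 1 ≤ d → 2 ≤ n → 1 ≤ m → m ≤ n →
      ∀ (f : Polynomial ℤ), f.natDegree ≤ d → ∀ (a : Fin n → ℝ),
        ∃ (t : ℕ) (s : RealRAM.State),
          RealRAM.Exec
            (fun v => ∀ q : Fin n → ℚ, (∀ i, a i = (q i : ℝ)) →
              MinConv.HasSizeLE (K * MinConv.inputSize d n m f q ^ e) v)
            P (MinConv.inputState d n m f a) t s ∧
          MinConv.IsReducedMinConv a
            (fun i : Fin m => ((f.eval ((i : ℕ) : ℤ) : ℤ) : ℝ)) (s.arr 2) ∧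
          (t : ℝ) ≤ C * (d : ℝ) ^ 3 *
            (n : ℝ) ^ (1 + (MinConv.sigma d - 1) / MinConv.sigma d) * (Real.log n) ^ 2 := by
  refine ⟨MinConv.mainCmd, 16000, 10, 2, fun d n m hd hn hm hmn f hf a => ?_⟩
  obtain ⟨t, s, hE, ht, hc⟩ := MinConv.wp_main hd hn hm hmn hf a
  refine ⟨t, s, hE, hc, le_trans ?_ (MinConv.nearly_linear_le_bound hd hn)⟩
  exact_mod_cast ht
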